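/- There are infinitely many distinct subfields $K$ of $\mathbb{C}$ that are finite Galois extensions of $\mathbb{Q}$ with $\operatorname{Gal}(K/\mathbb{Q})\cong PSL_2(7)$ (that is, $PSL_2(\mathbb{F}_7)$) and satisfy all of the following: - for every nonzero prime ideal $\mathfrak{P}$ of the ring of integers $\mathcal{O}_K$, the inertia group $\{\sigma\in\operatorname{Gal}(K/\mathbb{Q}) : \sigma(x)\equiv x \pmod{\mathfrak{P}} \text{ for all } x\in\mathcal{O}_K\}$ is either trivial or of order $2$; - $K/\mathbb{Q}$ is unramified at $2$; - $K$ is contained in $\mathbb{R}$, and $K$ is totally real. -/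

import Mathlib

open scoped NumberField MatrixGroups

open Equiv (Perm)
open Polynomial

/-! For `b ≡ 79 mod 210` and `b ≥ 20`, the splitting field in ℂ of the septic f = `laMacchia b` has
all the required properties; varying b gives infinitely many fields.

Galois group. An auxiliary septic g and the factorisation `laMacchia_incidence` attach to each root
of g three roots of f, which satisfy `FanoRelation`. For odd b, f is irreducible modulo 2, so a
Frobenius at 2 permutes its roots cyclically and labels them by ℤ/7. Reduction at 2 excludes the
relation on all four translation classes of triangles; as it holds for some triple, it is exactly
collinearity (`fanoThird_eq_iff_of_invariant`). Hence the group lies in `fanoAut`, a copy of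
PSL(2,7), and contains a 7-cycle. A Frobenius at 5 has even order, and that forces the whole group
(`eq_fanoAut_of_two_dvd_card`).

Inertia. An inertia element moves a root only to a root with the same reduction. The class of b
modulo 210 makes f separable at 2, 3, 5 and 7. At the other divisors of b, roots r that collide are
separated through the quotients b/r. At all remaining primes f keeps at least five distinct roots
(`laMacchia_five_le_card`), whereas a nontrivial collineation has at most five orbits, and five only
if it is an involution; the fibres of reduction then determine it (`fanoAut_eq_of_fiber`).

Reality and infinitude. Sign changes give seven real roots. If the fields were finitely many, each
would have a ramified prime by Minkowski's theorem; a b divisible by all of these primes outside 210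
yields a field unramified at every one of them, a contradiction. -/

/-! ### Collineations of the Fano plane -/

/-- The third point on the line through `i` and `j` in the Fano plane on `ZMod 7` whose lines are
the translates of `{0, 2, 3}`; by convention it is `i` if `i = j`. -/
def fanoThird (i j : ZMod 7) : ZMod 7 :=
  i + (![0, 5, 3, 2, 6, 1, 4] : ZMod 7 → ZMod 7) (j - i)

/-- The collineation group of the Fano plane. -/
def fanoAut : Subgroup (Perm (ZMod 7)) where
  carrier := {π | ∀ i j, π (fanoThird i j) = fanoThird (π i) (π j)}
  mul_mem' {a b} ha hb i j := by
    rw [Perm.mul_apply, hb i j]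
    exact ha _ _
  one_mem' i j := rfl
  inv_mem' {a} ha i j := by
    apply a.injective
    rw [ha]
    simp

theorem mem_fanoAut {π : Perm (ZMod 7)} :
    π ∈ fanoAut ↔ ∀ i j, π (fanoThird i j) = fanoThird (π i) (π j) := Iff.rfl

/-- The map determined on the Fano plane by the images of `0`, `1`, `2`. -/
def fanoExtend (p q r : ZMod 7) : ZMod 7 → ZMod 7 :=
  ![p, q, r, fanoThird p r, fanoThird q (fanoThird p r), fanoThird p q, fanoThird q r]

theorem fanoAut_apply {π : Perm (ZMod 7)} (h : π ∈ fanoAut) (i : ZMod 7) :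
    π i = fanoExtend (π 0) (π 1) (π 2) i := by
  have h3 : π 3 = fanoThird (π 0) (π 2) := h 0 2
  have h4 : π 4 = fanoThird (π 1) (π 3) := h 1 3
  have h5 : π 5 = fanoThird (π 0) (π 1) := h 0 1
  have h6 : π 6 = fanoThird (π 1) (π 2) := h 1 2
  rw [h3] at h4
  fin_cases i
  exacts [rfl, rfl, rfl, h3, h4, h5, h6]

theorem fanoAut_ext {π τ : Perm (ZMod 7)} (hπ : π ∈ fanoAut) (hτ : τ ∈ fanoAut)
    (h0 : π 0 = τ 0) (h1 : π 1 = τ 1) (h2 : π 2 = τ 2) : π = τ := by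
  ext1 i
  rw [fanoAut_apply hπ, fanoAut_apply hτ, h0, h1, h2]

/-- `p`, `q`, `r` are not collinear. -/
def FanoTriangle (p q r : ZMod 7) : Prop := p ≠ q ∧ p ≠ r ∧ q ≠ r ∧ fanoThird p q ≠ r

instance (p q r : ZMod 7) : Decidable (FanoTriangle p q r) := by
  unfold FanoTriangle; infer_instance

theorem fanoTriangle_of_mem {π : Perm (ZMod 7)} (h : π ∈ fanoAut) :
    FanoTriangle (π 0) (π 1) (π 2) := by
  refine ⟨π.injective.ne (by decide), π.injective.ne (by decide), π.injective.ne (by decide), ?_⟩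
  rw [← h 0 1]
  exact π.injective.ne (by decide)

/-- An involution of the Fano plane. -/
def fanoTau : ZMod 7 → ZMod 7 := ![0, 4, 2, 3, 1, 6, 5]

theorem fanoTau_fanoTau (i : ZMod 7) : fanoTau (fanoTau i) = i := by
  revert i; decide

/-- In characteristic 7 the inverse of `a` is `a ^ 5`: the Weyl element inverts the torus. -/
theorem fanoTau_mul (a i : ZMod 7) (h : a ≠ 0) : fanoTau (a * a * i) = (a ^ 5) ^ 2 * fanoTau i := by
  revert a i; decide

/-- The rank one relation rewriting w u(s) w in Bruhat form; it is what makes `fanoRho`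
multiplicative. -/
theorem fanoTau_add (s i : ZMod 7) (h : s ≠ 0) :
    fanoTau (fanoTau i + s) = fanoTau (s * s * i - s) - s ^ 5 := by
  revert s i; decide

/-- The rotation of the Fano plane. -/
def fanoRot : Perm (ZMod 7) := Equiv.addRight 1

/-- `fanoTau` as a permutation. -/
def fanoTauPerm : Perm (ZMod 7) := ⟨fanoTau, fanoTau, fanoTau_fanoTau, fanoTau_fanoTau⟩

/-- The doubling map of the Fano plane. -/
def fanoDouble : Perm (ZMod 7) := ⟨fun i => 2 * i, fun i => 4 * i, by decide, by decide⟩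

theorem fanoRot_mem : fanoRot ∈ fanoAut := by
  rw [mem_fanoAut]; decide

theorem fanoTauPerm_mem : fanoTauPerm ∈ fanoAut := by
  rw [mem_fanoAut]; decide

theorem fanoDouble_mem : fanoDouble ∈ fanoAut := by
  rw [mem_fanoAut]; decide

theorem fanoRot_pow_apply (n : ℕ) (i : ZMod 7) : (fanoRot ^ n) i = i + n := by
  induction n with
  | zero => simp
  | succ n ih => rw [pow_succ', Perm.mul_apply, ih]; simp [fanoRot, add_assoc]

/-- Bruhat decomposition of the collineation group. -/
theorem fano_bruhat (p q r : ZMod 7) (h : FanoTriangle p q r) :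
    (∃ e : ZMod 7, ∃ j : Fin 3, ∀ i : Fin 3, e + 2 ^ j.1 * (i.1 : ZMod 7) = ![p, q, r] i) ∨
    (∃ e : ZMod 7, ∃ j : Fin 3, ∃ k : ZMod 7, ∀ i : Fin 3,
      e + 2 ^ j.1 * fanoTau ((i.1 : ZMod 7) + k) = ![p, q, r] i) := by
  revert p q r; decide +kernel

/-- An involution fixes a line pointwise, and since lines are translates of a perfect difference
set, each contains two consecutive residues. -/
theorem fano_involution_fix (p q r : ZMod 7) :
    FanoTriangle p q r ∧ (∀ i, fanoExtend p q r (fanoExtend p q r i) = i) ∧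
      ¬ (p = 0 ∧ q = 1 ∧ r = 2) →
    ∃ k : ZMod 7, fanoExtend p q r k = k ∧ fanoExtend p q r (k + 1) = k + 1 := by
  revert p q r; decide +kernel

theorem fano_third_value (r : ZMod 7) : FanoTriangle 0 1 r ∧ r ≠ 2 → r = 3 ∨ r = 4 ∨ r = 6 := by
  revert r; decide

theorem fanoDouble_eq :
    fanoDouble = fanoTauPerm * fanoRot ^ 2 * fanoTauPerm * fanoRot ^ 4 * fanoTauPerm *
      fanoRot ^ 2 := by
  decide +kernel

/-- An involution of the Fano plane fixing `0` and `1`. -/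
def fanoInvolution (r : ZMod 7) (h : ∀ i, fanoExtend 0 1 r (fanoExtend 0 1 r i) = i) :
    Perm (ZMod 7) := ⟨fanoExtend 0 1 r, fanoExtend 0 1 r, h, h⟩

theorem fanoTauPerm_eq_three (h) : fanoTauPerm =
    fanoInvolution 3 h * fanoRot ^ 4 * fanoInvolution 3 h * fanoRot ^ 2 := by
  decide +revert +kernel

theorem fanoTauPerm_eq_four (h) : fanoTauPerm =
    fanoRot * fanoInvolution 4 h * fanoRot ^ 2 * fanoInvolution 4 h * fanoRot := by
  decide +revert +kernel

theorem fanoTauPerm_eq_six (h) : fanoTauPerm =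
    fanoRot ^ 2 * fanoInvolution 6 h * fanoRot ^ 5 := by
  decide +revert +kernel

theorem fanoAut_le_of_rot_mem_of_tau_mem {H : Subgroup (Perm (ZMod 7))} (hc : fanoRot ∈ H)
    (ht : fanoTauPerm ∈ H) : fanoAut ≤ H := by
  have hd : fanoDouble ∈ H := by
    rw [fanoDouble_eq]
    exact mul_mem (mul_mem (mul_mem (mul_mem (mul_mem ht (pow_mem hc _)) ht) (pow_mem hc _)) ht)
      (pow_mem hc _)
  have hdv : ∀ (j : ℕ) (i : ZMod 7), (fanoDouble ^ j) i = 2 ^ j * i := by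
    intro j i
    induction j with
    | zero => simp
    | succ j ih => rw [pow_succ', Perm.mul_apply, ih]; simp [fanoDouble, pow_succ']; ring
  have key : ∀ {π τ : Perm (ZMod 7)}, π ∈ fanoAut → τ ∈ fanoAut → τ ∈ H →
      (∀ i : Fin 3, τ (i.1 : ZMod 7) = ![π 0, π 1, π 2] i) → π ∈ H := by
    intro π τ hπ hτ hτH h
    rw [fanoAut_ext hπ hτ]
    · exact hτH
    · simpa using (h 0).symm
    · simpa using (h 1).symm
    · simpa using (h 2).symm
  intro π hπ
  rcases fano_bruhat _ _ _ (fanoTriangle_of_mem hπ) with ⟨e, j, h⟩ | ⟨e, j, k, h⟩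
  · refine key hπ (τ := fanoRot ^ e.val * fanoDouble ^ j.1)
      (mul_mem (pow_mem fanoRot_mem _) (pow_mem fanoDouble_mem _))
      (mul_mem (pow_mem hc _) (pow_mem hd _)) fun i => ?_
    rw [← h i, Perm.mul_apply, fanoRot_pow_apply, hdv, ZMod.natCast_zmod_val, add_comm]
  · refine key hπ (τ := fanoRot ^ e.val * fanoDouble ^ j.1 * fanoTauPerm * fanoRot ^ k.val)
      (mul_mem (mul_mem (mul_mem (pow_mem fanoRot_mem _) (pow_mem fanoDouble_mem _))
        fanoTauPerm_mem) (pow_mem fanoRot_mem _))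
      (mul_mem (mul_mem (mul_mem (pow_mem hc _) (pow_mem hd _)) ht) (pow_mem hc _)) fun i => ?_
    rw [← h i, Perm.mul_apply, Perm.mul_apply, Perm.mul_apply, fanoRot_pow_apply,
      fanoRot_pow_apply, hdv, ZMod.natCast_zmod_val, ZMod.natCast_zmod_val, add_comm]
    rfl

/-- A group of collineations of even order containing the rotation is the whole group. -/
theorem eq_fanoAut_of_two_dvd_card {H : Subgroup (Perm (ZMod 7))} (hH : H ≤ fanoAut)
    (hc : fanoRot ∈ H) (h2 : 2 ∣ Nat.card H) : H = fanoAut := by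
  refine le_antisymm hH (fanoAut_le_of_rot_mem_of_tau_mem hc ?_)
  obtain ⟨⟨τ, hτ⟩, ho⟩ := exists_prime_orderOf_dvd_card' 2 h2
  have hτ2 : ∀ i, τ (τ i) = i := by
    intro i
    have h : τ ^ 2 = 1 := by
      have := pow_orderOf_eq_one (⟨τ, hτ⟩ : H)
      rw [ho] at this
      simpa [Subtype.ext_iff] using this
    rw [← Perm.mul_apply, ← pow_two, h, Perm.one_apply]
  have hτ1 : τ ≠ 1 := by
    rintro rfl
    have : (⟨1, hτ⟩ : H) = 1 := rfl
    rw [this, orderOf_one] at ho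
    omega
  obtain ⟨k, hk0, hk1⟩ : ∃ k : ZMod 7, τ k = k ∧ τ (k + 1) = k + 1 := by
    have := fano_involution_fix (τ 0) (τ 1) (τ 2) ⟨fanoTriangle_of_mem (hH hτ), fun i => by
      rw [← fanoAut_apply (hH hτ), ← fanoAut_apply (hH hτ), hτ2], fun h => hτ1 <|
        fanoAut_ext (hH hτ) (one_mem _) h.1 h.2.1 h.2.2⟩
    simpa only [← fanoAut_apply (hH hτ)] using this
  set c := fanoRot ^ k.val with hcdef
  have hcv : ∀ i, c i = i + k := fun i => by
    rw [hcdef, fanoRot_pow_apply, ZMod.natCast_zmod_val]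
  have hcH : c ∈ H := pow_mem hc _
  -- Conjugating by a rotation moves the consecutive fixed points to 0 and 1. Only three involutions
  -- have this axis, and each yields `fanoTauPerm` as an explicit word.
  set π := c⁻¹ * τ * c with hπdef
  have hπH : π ∈ H := mul_mem (mul_mem (inv_mem hcH) hτ) hcH
  have hπ2 : ∀ i, π (π i) = i := by intro i; simp [hπdef, hτ2]
  have hπ0 : π 0 = 0 := by
    rw [hπdef, Perm.mul_apply, Perm.mul_apply, Perm.inv_eq_iff_eq, hcv, zero_add, hk0]
  have hπ1 : π 1 = 1 := by
    rw [hπdef, Perm.mul_apply, Perm.mul_apply, Perm.inv_eq_iff_eq, hcv, add_comm, hk1]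
  have hπne : π 2 ≠ 2 := fun h => hτ1 <| by
    have : π = 1 := fanoAut_ext (hH hπH) (one_mem _) hπ0 hπ1 h
    rw [hπdef, mul_assoc, inv_mul_eq_one, eq_comm] at this
    simpa using this
  have hπv := fanoAut_apply (hH hπH)
  rw [hπ0, hπ1] at hπv
  have hinv : ∀ i, fanoExtend 0 1 (π 2) (fanoExtend 0 1 (π 2) i) = i := fun i => by
    rw [← hπv, ← hπv, hπ2]
  have hπeq : π = fanoInvolution (π 2) hinv := Equiv.ext hπv
  have hmem : fanoInvolution (π 2) hinv ∈ H := hπeq ▸ hπH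
  have htri := fanoTriangle_of_mem (hH hπH)
  rw [hπ0, hπ1] at htri
  clear_value π
  generalize π 2 = r at hinv hmem htri hπne
  rcases fano_third_value r ⟨htri, hπne⟩ with rfl | rfl | rfl
  · rw [fanoTauPerm_eq_three hinv]
    exact mul_mem (mul_mem (mul_mem hmem (pow_mem hc _)) hmem) (pow_mem hc _)
  · rw [fanoTauPerm_eq_four hinv]
    exact mul_mem (mul_mem (mul_mem (mul_mem hc hmem) (pow_mem hc _)) hmem) hc
  · rw [fanoTauPerm_eq_six hinv]
    exact mul_mem (mul_mem (pow_mem hc _) hmem) (pow_mem hc _)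

/-! ### PSL(2,7) as the collineation group -/

instance Nat.fact_prime_seven : Fact (Nat.Prime 7) := ⟨by norm_num⟩

/-- The action of a matrix with rows `(a, b)` and `(c, d)` on the Fano plane, given by the Bruhat
decomposition. -/
def fanoRho (a b c d i : ZMod 7) : ZMod 7 :=
  if c = 0 then a * a * i + a * b else fanoTau (c * c * i + c * d) + a * c ^ 5

theorem ZMod.seven_pow_six {a : ZMod 7} (h : a ≠ 0) : a ^ 6 = 1 := by
  revert a; decide

/-- Compatibility with left multiplication by the Borel element with rows (α, β) and (0, α⁻¹). With
`fanoRho_weyl` this covers generators of SL(2,7). -/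
theorem fanoRho_upper {α β a b c d : ZMod 7} (i : ZMod 7) (hα : α ≠ 0) (h : a * d - b * c = 1) :
    fanoRho (α * a + β * c) (α * b + β * d) (α ^ 5 * c) (α ^ 5 * d) i =
      α * α * fanoRho a b c d i + α * β := by
  have hα6 := ZMod.seven_pow_six hα
  by_cases hc : c = 0
  · subst hc
    simp only [fanoRho, mul_zero, add_zero, if_true]
    linear_combination α * β * h
  · have hc6 := ZMod.seven_pow_six hc
    have hne : α ^ 5 * c ≠ 0 := mul_ne_zero (pow_ne_zero _ hα) hc
    simp only [fanoRho, if_neg hc, if_neg hne]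
    have : α ^ 5 * c * (α ^ 5 * c) * i + α ^ 5 * c * (α ^ 5 * d) =
        α ^ 5 * α ^ 5 * (c * c * i + c * d) := by ring
    rw [this, fanoTau_mul _ _ (pow_ne_zero _ hα)]
    have h1 : ((α ^ 5) ^ 5) ^ 2 = α * α := by
      calc _ = (α ^ 6) ^ 8 * (α * α) := by ring
        _ = _ := by rw [hα6]; ring
    have h2 : (α * a + β * c) * (α ^ 5 * c) ^ 5 =
        (α ^ 6) ^ 4 * (α * α * (a * c ^ 5)) + (α ^ 6) ^ 4 * c ^ 6 * (α * β) := by ring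
    rw [h1, h2, hα6, hc6]
    ring

theorem fanoRho_weyl {a b c d : ZMod 7} (i : ZMod 7) (h : a * d - b * c = 1) :
    fanoRho (-c) (-d) a b i = fanoTau (fanoRho a b c d i) := by
  by_cases hc : c = 0
  · subst hc
    have ha : a ≠ 0 := by rintro rfl; simp at h
    simp [fanoRho, ha]
  · have hc6 := ZMod.seven_pow_six hc
    by_cases ha : a = 0
    · subst ha
      simp [fanoRho, hc, fanoTau_fanoTau]
    · have ha6 := ZMod.seven_pow_six ha
      simp only [fanoRho, if_neg hc, if_neg ha]
      have h1 : a * c ^ 5 * (a * c ^ 5) * (c * c * i + c * d) - a * c ^ 5 = a * a * i + a * b := by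
        linear_combination (a ^ 2 * i * (c ^ 6 + 1) + a ^ 2 * c ^ 5 * d + a * b) * hc6 +
          a * c ^ 5 * h
      have h2 : (a * c ^ 5) ^ 5 = a ^ 5 * c := by
        linear_combination a ^ 5 * c * (c ^ 18 + c ^ 12 + c ^ 6 + 1) * hc6
      rw [fanoTau_add _ _ (mul_ne_zero ha (pow_ne_zero _ hc)), h1, h2]
      ring

theorem fanoRho_mul {a b c d a' b' c' d' : ZMod 7} (i : ZMod 7) (h : a * d - b * c = 1)
    (h' : a' * d' - b' * c' = 1) :
    fanoRho (a * a' + b * c') (a * b' + b * d') (c * a' + d * c') (c * b' + d * d') i =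
      fanoRho a b c d (fanoRho a' b' c' d' i) := by
  by_cases hc : c = 0
  · subst hc
    have ha : a ≠ 0 := by rintro rfl; simp at h
    have hd : d = a ^ 5 := by
      have ha6 := ZMod.seven_pow_six ha
      linear_combination a ^ 5 * h - d * ha6
    have := fanoRho_upper (β := b) i ha h'
    rw [zero_mul, zero_mul, zero_add, zero_add, hd, this]
    simp [fanoRho]
  -- For c ≠ 0 the left factor is u(a/c) · w · (c, d; 0, c⁻¹); the three factors are applied from
  -- right to left.
  · have hc6 := ZMod.seven_pow_six hc
    have h1 := fanoRho_upper (β := d) i hc h'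
    have hdet : (c * a' + d * c') * (c ^ 5 * d') - (c * b' + d * d') * (c ^ 5 * c') = 1 := by
      linear_combination c ^ 6 * h' + hc6
    have h2 := fanoRho_weyl i hdet
    have hdet2 : -(c ^ 5 * c') * (c * b' + d * d') - -(c ^ 5 * d') * (c * a' + d * c') = 1 := by
      linear_combination hdet
    have h3 := fanoRho_upper (α := 1) (β := a * c ^ 5) i one_ne_zero hdet2
    rw [h2, h1] at h3
    simp only [one_mul, one_pow] at h3
    have e1 : -(c ^ 5 * c') + a * c ^ 5 * (c * a' + d * c') = a * a' + b * c' := by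
      linear_combination (a * a' + b * c') * hc6 + c ^ 5 * c' * h
    have e2 : -(c ^ 5 * d') + a * c ^ 5 * (c * b' + d * d') = a * b' + b * d' := by
      linear_combination (a * b' + b * d') * hc6 + c ^ 5 * d' * h
    rw [e1, e2] at h3
    rw [h3]
    simp [fanoRho, hc]

theorem fanoRho_one (i : ZMod 7) : fanoRho 1 0 0 1 i = i := by simp [fanoRho]

theorem fanoThird_affine (a e i j : ZMod 7) :
    a ≠ 0 → a * a * fanoThird i j + e = fanoThird (a * a * i + e) (a * a * j + e) := by
  revert a e i j; decide +kernel

theorem fanoThird_add (e i j : ZMod 7) : fanoThird i j + e = fanoThird (i + e) (j + e) := by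
  simpa using fanoThird_affine 1 e i j one_ne_zero

theorem fanoRho_third {a b c d : ZMod 7} (h : a * d - b * c = 1) (i j : ZMod 7) :
    fanoRho a b c d (fanoThird i j) = fanoThird (fanoRho a b c d i) (fanoRho a b c d j) := by
  by_cases hc : c = 0
  · subst hc
    have ha : a ≠ 0 := by rintro rfl; simp at h
    simp only [fanoRho, if_true, fanoThird_affine _ _ _ _ ha]
  · simp only [fanoRho, if_neg hc]
    rw [fanoThird_affine c (c * d) i j hc, ← fanoThird_add (a * c ^ 5)]
    exact congrArg (· + a * c ^ 5) (fanoTauPerm_mem (c * c * i + c * d) (c * c * j + c * d))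

theorem Matrix.SpecialLinearGroup.det_two {R : Type*} [CommRing R] (g : SL(2, R)) :
    g 0 0 * g 1 1 - g 0 1 * g 1 0 = 1 := by
  rw [← Matrix.det_fin_two]; exact g.2

/-- The action of `SL(2, 7)` on the Fano plane. -/
def fanoHom : SL(2, ZMod 7) →* Perm (ZMod 7) :=
  MonoidHom.toHomPerm
    { toFun g := (fanoRho (g 0 0) (g 0 1) (g 1 0) (g 1 1) : Function.End (ZMod 7))
      map_one' := funext fun i => fanoRho_one i
      map_mul' g h := funext fun i => by
        refine Eq.trans ?_ (fanoRho_mul i g.det_two h.det_two)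
        simp [Matrix.mul_apply, Fin.sum_univ_two] }

theorem fanoHom_apply (g : SL(2, ZMod 7)) (i : ZMod 7) :
    fanoHom g i = fanoRho (g 0 0) (g 0 1) (g 1 0) (g 1 1) i := rfl

theorem fanoHom_range : fanoHom.range = fanoAut := by
  refine le_antisymm ?_ (fanoAut_le_of_rot_mem_of_tau_mem ?_ ?_)
  · rintro _ ⟨g, rfl⟩ i j
    exact fanoRho_third g.det_two i j
  · refine ⟨⟨!![1, 1; 0, 1], by simp [Matrix.det_fin_two]⟩, Equiv.ext fun i => ?_⟩
    change fanoRho 1 1 0 1 i = i + 1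
    simp [fanoRho]
  · refine ⟨⟨!![0, -1; 1, 0], by simp [Matrix.det_fin_two]⟩, Equiv.ext fun i => ?_⟩
    change fanoRho 0 (-1) 1 0 i = fanoTau i
    simp [fanoRho]

theorem fanoRho_eq_id (a b c d : ZMod 7) : a * d - b * c = 1 ∧ (∀ i, fanoRho a b c d i = i) →
    (a = 1 ∨ a = -1) ∧ b = 0 ∧ c = 0 ∧ d = a := by
  revert a b c d; decide +kernel

theorem fanoHom_ker : fanoHom.ker = Subgroup.center SL(2, ZMod 7) := by
  ext g
  rw [MonoidHom.mem_ker, Matrix.SpecialLinearGroup.mem_center_iff]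
  constructor
  · intro h
    obtain ⟨ha, hb, hc, hd⟩ := fanoRho_eq_id (g 0 0) (g 0 1) (g 1 0) (g 1 1)
      ⟨g.det_two, fun i => by rw [← fanoHom_apply, h]; rfl⟩
    refine ⟨g 0 0, ?_, ?_⟩
    · rcases ha with ha | ha <;> simp [ha]
    · ext i j
      fin_cases i <;> fin_cases j <;> simp [hb, hc, hd]
  · rintro ⟨r, hr, h⟩
    have e := fun i j => congrFun (congrFun h i) j
    have h00 := e 0 0
    have h01 := e 0 1
    have h10 := e 1 0
    have h11 := e 1 1
    simp at h00 h01 h10 h11 hr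
    ext1 i
    rw [fanoHom_apply, ← h00, ← h01, ← h10, ← h11]
    have : r * r = 1 := by rcases hr with rfl | rfl <;> norm_num
    simp [fanoRho, this]

/-- `PSL(2, 7)` is the collineation group of the Fano plane. -/
noncomputable def pslEquivFanoAut : PSL(2, ZMod 7) ≃* fanoAut :=
  (QuotientGroup.quotientMulEquivOfEq fanoHom_ker.symm).trans <|
    (QuotientGroup.quotientKerEquivRange fanoHom).trans (MulEquiv.subgroupCongr fanoHom_range)

/-! ### Collineations preserving the fibres of a map -/

/-- The smaller of two elements of `ZMod 7`. -/
def ZMod.minSeven (i j : ZMod 7) : ZMod 7 := if i.val ≤ j.val then i else j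

theorem ZMod.apply_minSeven {κ : Type*} (v : ZMod 7 → κ) {i j : ZMod 7} (h : v j = v i) :
    v (ZMod.minSeven i j) = v i := by
  unfold ZMod.minSeven; split_ifs <;> simp [h]

/-- The smallest element of the orbit of `i` under the self-map `e` of `ZMod 7`. -/
def ZMod.orbitMin (e : ZMod 7 → ZMod 7) (i : ZMod 7) : ZMod 7 :=
  [e i, e (e i), e (e (e i)), e (e (e (e i))), e (e (e (e (e i)))),
    e (e (e (e (e (e i)))))].foldl ZMod.minSeven i

theorem ZMod.apply_foldl_minSeven {κ : Type*} (v : ZMod 7 → κ) (l : List (ZMod 7)) (i : ZMod 7)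
    (h : ∀ j ∈ l, v j = v i) : v (l.foldl ZMod.minSeven i) = v i := by
  induction l generalizing i with
  | nil => rfl
  | cons j l ih =>
    have hj := ZMod.apply_minSeven v (h j (by simp))
    rw [List.foldl_cons, ih _ fun k hk => ?_, hj]
    rw [hj, h k (by simp [hk])]

theorem ZMod.apply_orbitMin {κ : Type*} {v : ZMod 7 → κ} {e : ZMod 7 → ZMod 7}
    (h : ∀ i, v (e i) = v i) (i : ZMod 7) : v (ZMod.orbitMin e i) = v i :=
  ZMod.apply_foldl_minSeven v _ _ (by simp [h])

/-- Nontrivial collineations have cycle types 1³2², 1·3², 1·2·4 and 7, so only involutions reach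
five orbits. -/
theorem fanoExtend_orbits (p q r : ZMod 7) :
    FanoTriangle p q r ∧ ¬ (p = 0 ∧ q = 1 ∧ r = 2) →
    ((∀ i, fanoExtend p q r (fanoExtend p q r i) = i) ∧
      (Finset.univ.image fun i => ZMod.minSeven i (fanoExtend p q r i)).card ≤ 5) ∨
    (Finset.univ.image (ZMod.orbitMin (fanoExtend p q r))).card ≤ 4 := by
  revert p q r; decide +kernel

/-- If the fibres of a map with at least five values are preserved by a nontrivial collineation
`π`, then they are the orbits of `π`, and `π` is an involution. -/
theorem fanoAut_fiber {κ : Type*} [DecidableEq κ] {v : ZMod 7 → κ}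
    (h5 : 5 ≤ (Finset.univ.image v).card) {π : Perm (ZMod 7)} (hπ : π ∈ fanoAut) (hπ1 : π ≠ 1)
    (hv : ∀ i, v (π i) = v i) {i j : ZMod 7} (hij : v i = v j) : j = i ∨ j = π i := by
  have himg : ∀ {s : ZMod 7 → ZMod 7}, (∀ i, v (s i) = v i) →
      Finset.univ.image v = (Finset.univ.image s).image v := by
    intro s hs
    rw [Finset.image_image]
    exact Finset.image_congr fun i _ => (hs i).symm
  have hE : ∀ i, fanoExtend (π 0) (π 1) (π 2) i = π i := fun i => (fanoAut_apply hπ i).symm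
  have hE' : fanoExtend (π 0) (π 1) (π 2) = π := funext hE
  rcases fanoExtend_orbits (π 0) (π 1) (π 2) ⟨fanoTriangle_of_mem hπ, fun h => hπ1 <|
    fanoAut_ext hπ (one_mem _) h.1 h.2.1 h.2.2⟩ with ⟨hinv, hcard⟩ | hcard
  · rw [hE'] at hinv hcard
    have hs : ∀ i, v (ZMod.minSeven i (π i)) = v i := fun i => ZMod.apply_minSeven v (hv i)
    rw [himg hs] at h5
    have hinj := Finset.card_image_iff.1
      (le_antisymm Finset.card_image_le (hcard.trans h5))
    have := hinj (by simp) (by simp) ((hs i).trans (hij.trans (hs j).symm))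
    have key : ∀ i, ZMod.minSeven i (π i) = i ∨ ZMod.minSeven i (π i) = π i := by
      intro i; unfold ZMod.minSeven; split_ifs <;> simp
    rcases key i with h | h <;> rcases key j with h' | h' <;> rw [h, h'] at this
    · exact Or.inl this.symm
    · right; rw [this, hinv]
    · exact Or.inr this.symm
    · exact Or.inl (π.injective this).symm
  · rw [hE'] at hcard
    rw [himg (ZMod.apply_orbitMin hv)] at h5
    exact absurd (h5.trans (Finset.card_image_le.trans hcard)) (by norm_num)

theorem fanoAut_eq_of_fiber {κ : Type*} [DecidableEq κ] {v : ZMod 7 → κ}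
    (h5 : 5 ≤ (Finset.univ.image v).card) {π τ : Perm (ZMod 7)} (hπ : π ∈ fanoAut) (hπ1 : π ≠ 1)
    (hv : ∀ i, v (π i) = v i) (hτ : τ ∈ fanoAut) (hτ1 : τ ≠ 1) (hw : ∀ i, v (τ i) = v i) :
    π = τ := by
  ext1 i
  by_cases h : π i = i
  · rcases fanoAut_fiber h5 hτ hτ1 hw (hw i).symm with h' | h'
    · rw [h, h']
    rcases fanoAut_fiber h5 hπ hπ1 hv (hw i).symm with h'' | h''
    · rw [h, h'']
    · exact h''.symm
  · rcases fanoAut_fiber h5 hτ hτ1 hw (hv i).symm with h' | h'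
    · exact absurd h' h
    · exact h'

/-! ### Frobenius elements and inertia in Galois number fields -/

section GaloisNumberField

variable (K : Type*) [Field K] [NumberField K] [IsGalois ℚ K]

/-- Over every rational prime `p` there is a prime with a Frobenius element. -/
theorem NumberField.exists_frobenius (p : ℕ) [Fact p.Prime] :
    ∃ P : Ideal (𝓞 K), P.IsMaximal ∧ (p : 𝓞 K) ∈ P ∧
      ∃ φ : K ≃ₐ[ℚ] K, ∀ x : 𝓞 K, φ • x - x ^ p ∈ P := by
  have := Int.ideal_span_isMaximal_of_prime p
  obtain ⟨P, hP, hlo⟩ := Ideal.exists_maximal_ideal_liesOver_of_isIntegral (S := 𝓞 K)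
    (Ideal.span {(p : ℤ)})
  have hfin : Finite (𝓞 K ⧸ P) :=
    Ideal.finiteQuotientOfFreeOfNeBot P (Ideal.IsMaximal.ne_bot_of_isIntegral_int P)
  obtain ⟨φ, hφ⟩ := IsArithFrobAt.exists_of_isInvariant ℤ (K ≃ₐ[ℚ] K) P
  have hcard : Nat.card (ℤ ⧸ P.under ℤ) = p := by
    rw [← hlo.over]; exact Int.card_ideal_quot p
  refine ⟨P, hP, ?_, φ, fun x => ?_⟩
  · have : (p : ℤ) ∈ P.under ℤ := by
      rw [← hlo.over]; exact Ideal.mem_span_singleton_self _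
    simpa using this
  · have := hφ x
    rw [hcard] at this
    exact this

variable {K} in
theorem NumberField.isUnramifiedIn_of_inertia_eq_bot (p : ℕ) [Fact p.Prime]
    (h : ∀ P : Ideal (𝓞 K), P.IsMaximal → (p : 𝓞 K) ∈ P → P.inertia (K ≃ₐ[ℚ] K) = ⊥) :
    Algebra.IsUnramifiedIn (𝓞 K) (Ideal.span {(p : ℤ)}) := by
  have hp := Int.ideal_span_isMaximal_of_prime p
  have hp0 : Ideal.span {(p : ℤ)} ≠ ⊥ := by
    simpa using (Fact.out : p.Prime).ne_zero
  rw [Algebra.isUnramifiedIn_iff_forall_ramificationIdx_eq_one]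
  intro P hP hlo
  have hmax : P.IsMaximal := hP.isMaximal (Ideal.ne_bot_of_liesOver_of_ne_bot hp0 P)
  rw [← Ideal.ramificationIdxIn_eq_ramificationIdx (Ideal.span {(p : ℤ)}) P (K ≃ₐ[ℚ] K),
    ← Ideal.card_inertia_eq_ramificationIdxIn (G := K ≃ₐ[ℚ] K) (Ideal.span {(p : ℤ)}) P, h P hmax]
  · simp
  · have : (p : ℤ) ∈ P.under ℤ := by
      rw [← hlo.over]; exact Ideal.mem_span_singleton_self _
    simpa using this

end GaloisNumberField

/-- A group action permuting the values of an injective family permutes the indices. -/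
theorem MulAction.exists_permHom {G α ι : Type*} [Group G] [MulAction G α] {r : ι → α}
    (hr : Function.Injective r) (h : ∀ (σ : G) i, ∃ j, r j = σ • r i) :
    ∃ Φ : G →* Perm ι, ∀ σ i, r (Φ σ i) = σ • r i := by
  choose f hf using h
  refine ⟨MonoidHom.toHomPerm
    { toFun σ := (f σ : Function.End ι)
      map_one' := funext fun i => hr (by rw [hf, one_smul]; rfl)
      map_mul' σ τ := funext fun i => hr ?_ }, fun σ i => hf σ i⟩
  change r (f (σ * τ) i) = r (f σ (f τ i))
  rw [hf, hf, hf, mul_smul]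

/-! ### Coincidences among the roots of a split polynomial -/

section ProdRoots

variable {ι k : Type*} [Fintype ι] [Field k]

theorem Polynomial.exists_eq_of_eval_prod_X_sub_C_eq_zero {ι R : Type*} [Fintype ι] [CommRing R]
    [IsDomain R] {ρ : ι → R} {x : R}
    (h : (∏ i, (X - C (ρ i))).eval x = 0) : ∃ i, ρ i = x := by
  rw [eval_prod, Finset.prod_eq_zero_iff] at h
  obtain ⟨i, -, hi⟩ := h
  exact ⟨i, by simpa [sub_eq_zero, eq_comm] using hi⟩

/-- A common multiple of a product of linear factors and its derivative has at least as many roots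
as there are coincidences among these factors. -/
theorem Polynomial.card_le_natDegree_add_card_image [DecidableEq k] {ρ : ι → k}
    {U V E : k[X]} (hE : E ≠ 0)
    (h : U * ∏ i, (X - C (ρ i)) + V * derivative (∏ i, (X - C (ρ i))) = E) :
    Fintype.card ι ≤ E.natDegree + (Finset.univ.image ρ).card := by
  set F := ∏ i, (X - C (ρ i)) with hF
  have hF0 : F ≠ 0 := Finset.prod_ne_zero_iff.2 fun i _ => X_sub_C_ne_zero _
  have hroots : F.roots = Finset.univ.val.map ρ := by
    rw [hF, roots_prod _ _ hF0]
    simp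
  -- A root of multiplicity m + 1 of F has multiplicity at least m in F', hence in E.
  have hcount : ∀ x, F.roots.count x ≤ E.roots.count x + 1 := by
    intro x
    by_cases hx : F.roots.count x = 0
    · omega
    obtain ⟨m, hm⟩ := Nat.exists_eq_succ_of_ne_zero hx
    have h1 : (X - C x) ^ (m + 1) ∣ F := by
      rw [← le_rootMultiplicity_iff hF0, ← count_roots, hm]
    have h2 : (X - C x) ^ m ∣ derivative F := by
      obtain ⟨q, hq⟩ := h1
      rw [hq, derivative_mul, derivative_X_sub_C_pow]
      refine dvd_add ?_ ?_
      · rw [Nat.add_sub_cancel]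
        exact ((Dvd.intro_left _ rfl).mul_right _)
      · exact (pow_dvd_pow _ (Nat.le_succ m)).mul_right _
    have h3 : (X - C x) ^ m ∣ E := by
      rw [← h]
      exact dvd_add (((pow_dvd_pow _ (Nat.le_succ m)).trans h1).mul_left _) (h2.mul_left _)
    rw [count_roots E, hm]
    have := (le_rootMultiplicity_iff hE).2 h3
    omega
  have hle : F.roots ≤ E.roots + (Finset.univ.image ρ).val := by
    rw [Multiset.le_iff_count]
    intro x
    rw [Multiset.count_add]
    by_cases hx : x ∈ Finset.univ.image ρ
    · have : Multiset.count x (Finset.univ.image ρ).val = 1 :=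
        Multiset.count_eq_one_of_mem (Finset.univ.image ρ).nodup hx
      rw [this]
      exact hcount x
    · have : x ∉ F.roots := by
        rw [hroots]
        simpa using hx
      rw [Multiset.count_eq_zero_of_notMem this]
      exact Nat.zero_le _
  have hc := Multiset.card_le_card hle
  rw [hroots, Multiset.card_add, Multiset.card_map] at hc
  exact hc.trans (Nat.add_le_add_right (card_roots' E) _)

theorem Polynomial.eval_derivative_prod_X_sub_C_eq_zero [DecidableEq ι] {ρ : ι → k}
    {i j : ι} (hij : i ≠ j)
    (h : ρ i = ρ j) : (derivative (∏ l, (X - C (ρ l)))).eval (ρ i) = 0 := by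
  have h1 : (X - C (ρ i)) ^ 2 ∣ ∏ l, (X - C (ρ l)) := by
    have := Finset.prod_dvd_prod_of_subset {i, j} Finset.univ (fun l => X - C (ρ l))
      (Finset.subset_univ _)
    rwa [Finset.prod_pair hij, ← h, ← pow_two] at this
  obtain ⟨q, hq⟩ := h1
  rw [hq, derivative_mul, derivative_X_sub_C_pow]
  simp

end ProdRoots

/-! ### The family of septics and its incidence relation -/

section Family

variable {A B : Type*} [CommRing A] [CommRing B]

/-- A specialisation of LaMacchia's family of polynomials of degree seven with Galois group
`PSL(2, 7)`. -/
noncomputable def laMacchia (b : A) : A[X] :=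
  X ^ 7 + C (2 - 3 * b) * X ^ 6 + C (2 * b ^ 2 + 2 * b - 3) * X ^ 5 +
    C (-3 * b ^ 2 + 12 * b - 2) * X ^ 4 + C (-b ^ 3 + b ^ 2 - 11 * b + 2) * X ^ 3 +
    C (b ^ 3 + 4 * b ^ 2) * X ^ 2 + C (b ^ 3 - 3 * b ^ 2) * X - C (b ^ 3)

theorem laMacchia_map (φ : A →+* B) (b : A) : (laMacchia b).map φ = laMacchia (φ b) := by
  simp only [laMacchia, Polynomial.map_sub, Polynomial.map_add, Polynomial.map_mul,
    Polynomial.map_pow, map_X, map_C, Polynomial.map_neg,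
    Polynomial.map_ofNat, map_sub, map_add, map_mul,
    map_pow, map_neg, map_ofNat]

theorem laMacchia_eval (b x : A) : (laMacchia b).eval x =
    x ^ 7 + (2 - 3 * b) * x ^ 6 + (2 * b ^ 2 + 2 * b - 3) * x ^ 5 +
    (-3 * b ^ 2 + 12 * b - 2) * x ^ 4 + (-b ^ 3 + b ^ 2 - 11 * b + 2) * x ^ 3 +
    (b ^ 3 + 4 * b ^ 2) * x ^ 2 + (b ^ 3 - 3 * b ^ 2) * x - b ^ 3 := by
  simp [laMacchia]

theorem laMacchia_derivative (b : A) : derivative (laMacchia b) =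
    7 * X ^ 6 + 6 * C (2 - 3 * b) * X ^ 5 + 5 * C (2 * b ^ 2 + 2 * b - 3) * X ^ 4 +
    4 * C (-3 * b ^ 2 + 12 * b - 2) * X ^ 3 + 3 * C (-b ^ 3 + b ^ 2 - 11 * b + 2) * X ^ 2 +
    2 * C (b ^ 3 + 4 * b ^ 2) * X + C (b ^ 3 - 3 * b ^ 2) := by
  simp only [laMacchia, derivative_add, derivative_sub, derivative_C_mul, derivative_X_pow,
    derivative_C, derivative_X]
  simp only [Nat.cast_ofNat, C_ofNat]
  ring

theorem laMacchia_derivative_eval (b x : A) : (derivative (laMacchia b)).eval x =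
    7 * x ^ 6 + 6 * (2 - 3 * b) * x ^ 5 + 5 * (2 * b ^ 2 + 2 * b - 3) * x ^ 4 +
    4 * (-3 * b ^ 2 + 12 * b - 2) * x ^ 3 + 3 * (-b ^ 3 + b ^ 2 - 11 * b + 2) * x ^ 2 +
    2 * (b ^ 3 + 4 * b ^ 2) * x + (b ^ 3 - 3 * b ^ 2) := by
  simp [laMacchia_derivative]

theorem laMacchia_monic (b : A) : (laMacchia b).Monic := by
  unfold laMacchia
  monicity!

theorem laMacchia_natDegree [Nontrivial A] (b : A) : (laMacchia b).natDegree = 7 := by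
  unfold laMacchia
  compute_degree!

/-- The relation satisfied by the roots on a line of the Fano plane. -/
def FanoRelation (b x y z : A) : Prop :=
  (x + y + z) * (b - x * y * z) * b =
    (b - 1) * (b - x * y * z) * b + (b - x * y * z) ^ 2 - b ^ 3

theorem FanoRelation.map {b x y z : A} (h : FanoRelation b x y z) (φ : A →+* B) :
    FanoRelation (φ b) (φ x) (φ y) (φ z) := by
  have := congrArg φ h
  simpa [FanoRelation] using this

theorem FanoRelation.swap {b x y z : A} (h : FanoRelation b x y z) : FanoRelation b y x z := by
  unfold FanoRelation at *
  linear_combination h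

theorem FanoRelation.rotate {b x y z : A} (h : FanoRelation b x y z) : FanoRelation b y z x := by
  unfold FanoRelation at *
  linear_combination h

/-- Factorisation of the correspondence between the roots and the lines. -/
theorem laMacchia_incidence (b x y : A) :
    (x ^ 3 * y + x * y ^ 3 - x ^ 2 * y ^ 2 - (b - 1) * (x ^ 2 * y + x * y ^ 2) +
      b * (x ^ 2 + y ^ 2) + (2 * b - 2) * (x * y) - b * (x + y)) *
    (x ^ 4 * y ^ 3 - x ^ 4 * y ^ 2 + x ^ 3 * y ^ 4 - 2 * x ^ 3 * y ^ 3 * b + x ^ 3 * y ^ 2 * b -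
      x ^ 3 * y ^ 2 + x ^ 3 * y * b - x ^ 2 * y ^ 4 + x ^ 2 * y ^ 3 * b - x ^ 2 * y ^ 3 +
      x ^ 2 * y ^ 2 * b ^ 2 + 2 * x ^ 2 * y ^ 2 - x ^ 2 * y * b - x ^ 2 * b ^ 2 + x * y ^ 3 * b -
      x * y ^ 2 * b + x * y * b ^ 2 - y ^ 2 * b ^ 2) =
    (y ^ 4 - y ^ 3) * (x ^ 7 + (2 - 3 * b) * x ^ 6 + (2 * b ^ 2 + 2 * b - 3) * x ^ 5 +
      (-3 * b ^ 2 + 12 * b - 2) * x ^ 4 + (-b ^ 3 + b ^ 2 - 11 * b + 2) * x ^ 3 +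
      (b ^ 3 + 4 * b ^ 2) * x ^ 2 + (b ^ 3 - 3 * b ^ 2) * x - b ^ 3) +
    (x ^ 4 - x ^ 3) * (y ^ 7 + (2 - 3 * b) * y ^ 6 + (2 * b ^ 2 + 2 * b - 3) * y ^ 5 +
      (-4 * b ^ 2 - 6 * b - 2) * y ^ 4 + (-b ^ 3 + 2 * b ^ 2 + 7 * b + 2) * y ^ 3 +
      (b ^ 3 + 4 * b ^ 2) * y ^ 2 + (b ^ 3 - 3 * b ^ 2) * y - b ^ 3) := by
  ring

end Family

/-! ### Reduction modulo 2 -/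

section CharTwo

variable {k : Type*} [Field k] [CharP k 2]

theorem laMacchia_root_pow {x : k} (h : (laMacchia (1 : k)).eval x = 0) :
    x ^ 8 = x ^ 2 + x + 1 ∧ x ^ 16 = x ^ 4 + x ^ 2 + 1 ∧ x ^ 32 = x ^ 4 + x ^ 2 + x ∧
      x ^ 64 = x ^ 4 + x + 1 ∧ x ^ 128 = x := by
  have h2 : (2 : k) = 0 := CharTwo.two_eq_zero
  have hf : x ^ 7 + x ^ 6 + x ^ 5 + x ^ 4 + x ^ 3 + x ^ 2 + 1 = 0 := by
    rw [laMacchia_eval] at h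
    linear_combination h + (x ^ 6 - 3 * x ^ 4 + 5 * x ^ 3 - 2 * x ^ 2 + x + 1) * h2
  have h8 : x ^ 8 = x ^ 2 + x + 1 := by linear_combination (x - 1) * hf - x * h2
  have h16 : x ^ 16 = x ^ 4 + x ^ 2 + 1 := by
    have : x ^ 16 = (x ^ 8) ^ 2 := by ring
    rw [this, h8]; linear_combination (x ^ 3 + x ^ 2 + x) * h2
  have h32 : x ^ 32 = x ^ 4 + x ^ 2 + x := by
    have : x ^ 32 = (x ^ 16) ^ 2 := by ring
    rw [this, h16]
    linear_combination (x - 1) * hf + (x ^ 6 + x ^ 4 + x ^ 2 - x + 1) * h2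
  have h64 : x ^ 64 = x ^ 4 + x + 1 := by
    have : x ^ 64 = (x ^ 32) ^ 2 := by ring
    rw [this, h32]
    linear_combination (x - 1) * hf + (x ^ 6 + x ^ 5 + x ^ 3 + x ^ 2 - x) * h2
  refine ⟨h8, h16, h32, h64, ?_⟩
  have : x ^ 128 = (x ^ 64) ^ 2 := by ring
  rw [this, h64]
  linear_combination (x - 1) * hf + (x ^ 5 + x ^ 4 + x ^ 2 + 1) * h2

/-- The conjugates of a root of the reduction modulo two are distinct. -/
theorem laMacchia_conjugates_injective {x : k} (h : (laMacchia (1 : k)).eval x = 0) :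
    Function.Injective fun i : ZMod 7 => x ^ 2 ^ i.val := by
  have h2 : (2 : k) = 0 := CharTwo.two_eq_zero
  have hiter : ∀ n, (fun y : k => y ^ 2)^[n] x = x ^ 2 ^ n := by
    intro n
    induction n with
    | zero => simp
    | succ n ih => rw [Function.iterate_succ_apply', ih, ← pow_mul, pow_succ]
  have hper : Function.IsPeriodicPt (fun y : k => y ^ 2) 7 x := by
    rw [Function.IsPeriodicPt, Function.IsFixedPt, hiter]
    exact (laMacchia_root_pow h).2.2.2.2
  have hmin : Function.minimalPeriod (fun y : k => y ^ 2) x = 7 := by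
    -- The period divides 7; period 1 would put x in the prime field, where the septic has no root.
    rcases (Nat.dvd_prime (by norm_num : Nat.Prime 7)).1 hper.minimalPeriod_dvd with h1 | h1
    · exfalso
      have : x ^ 2 = x := by
        have := Function.isPeriodicPt_minimalPeriod (fun y : k => y ^ 2) x
        rw [h1] at this
        exact this
      have hx : x = 0 ∨ x = 1 := by
        have : x * (x - 1) = 0 := by linear_combination this
        rcases mul_eq_zero.1 this with h | h
        · exact Or.inl h
        · exact Or.inr (by linear_combination h)
      rw [laMacchia_eval] at h
      rcases hx with rfl | rfl
      · norm_num at h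
      · exact one_ne_zero (α := k) (by linear_combination h)
    · exact h1
  intro i j hij
  have := (Function.iterate_eq_iterate_iff_of_lt_minimalPeriod
    (f := fun y : k => y ^ 2) (x := x) (m := i.val) (n := j.val)
    (by rw [hmin]; exact ZMod.val_lt i) (by rw [hmin]; exact ZMod.val_lt j)).1
    (by rw [hiter, hiter]; exact hij)
  exact ZMod.val_injective 7 this

/-- The conjugates with Frobenius exponents 012, 024, 036, 013 represent the translation classes of
triangles. The multiplier of `hL` in each certificate inverts the defect of the relation modulo 2
and the septic. -/
theorem laMacchia_not_fanoRelation {x : k} (h : (laMacchia (1 : k)).eval x = 0) :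
    ¬ FanoRelation 1 x (x ^ 2) (x ^ 4) ∧ ¬ FanoRelation 1 x (x ^ 4) (x ^ 16) ∧
      ¬ FanoRelation 1 x (x ^ 8) (x ^ 64) ∧ ¬ FanoRelation 1 x (x ^ 2) (x ^ 8) := by
  have h2 : (2 : k) = 0 := CharTwo.two_eq_zero
  obtain ⟨h8, h16, -, h64, -⟩ := laMacchia_root_pow h
  have hf : x ^ 7 + x ^ 6 + x ^ 5 + x ^ 4 + x ^ 3 + x ^ 2 + 1 = 0 := by
    rw [laMacchia_eval] at h
    linear_combination h + (x ^ 6 - 3 * x ^ 4 + 5 * x ^ 3 - 2 * x ^ 2 + x + 1) * h2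
  rw [h8, h16, h64]
  refine ⟨fun hL => ?_, fun hL => ?_, fun hL => ?_, fun hL => ?_⟩ <;> unfold FanoRelation at hL <;>
    refine one_ne_zero (α := k) ?_
  · linear_combination (x^5 + x^6) * hL - (7 - 2 * x - x ^ 2 + 3 * x ^ 3 - 4 * x ^ 4 + x ^ 5 + 4 *
      x ^ 6 - 2 * x ^ 7 - x ^ 10 + x ^ 11 - x ^ 13) * hf - (-4 + x - 3 * x ^ 2 - 4 * x ^ 3 - 4 * x
      ^ 5 - 3 * x ^ 6) * h2
  · linear_combination (1 + x^4 + x^6) * hL - (32 - 23 * x + 17 * x ^ 2 - 13 * x ^ 3 + 13 * x ^ 4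
      - 13 * x ^ 5 + 13 * x ^ 6 - 12 * x ^ 7 + 8 * x ^ 8 - 6 * x ^ 9 + 3 * x ^ 10 - 5 * x ^ 11 + 3
      * x ^ 12 - 5 * x ^ 13 + 3 * x ^ 14 - 3 * x ^ 15 + x ^ 16 - x ^ 17) * hf - (-16 + 12 * x - 24
      * x ^ 2 + 2 * x ^ 3 - 18 * x ^ 4 + x ^ 5 - 19 * x ^ 6) * h2
  · linear_combination (x + x^2 + x^4 + x^6) * hL - (5 + 2 * x - 6 * x ^ 2 - 11 * x ^ 3 - 9 * x ^
      4 - 11 * x ^ 5 - 7 * x ^ 6 - 10 * x ^ 7 - 8 * x ^ 8 - 5 * x ^ 9 - 3 * x ^ 10 - 2 * x ^ 11 -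
      x ^ 12 - x ^ 13) * hf - (-3 + 3 * x ^ 2 + 2 * x ^ 3 - 2 * x ^ 4 - x ^ 5 - 3 * x ^ 6) * h2
  · linear_combination (1 + x^4 + x^5 + x^6) * hL - (2 * x + 4 * x ^ 2 + x ^ 3 - 3 * x ^ 5 - 3 * x
      ^ 6 - 3 * x ^ 7 - 2 * x ^ 8 - x ^ 9) * hf - (-x ^ 2 - x ^ 3 - 3 * x ^ 4 - 2 * x ^ 5 - 2 * x
      ^ 6) * h2

end CharTwo

/-! ### Collinearity as an algebraic relation between roots -/

/-- A monic polynomial is determined by a full set of distinct roots. -/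
theorem Polynomial.Monic.eq_prod_X_sub_C_of_injective {ι R : Type*} [Fintype ι] [CommRing R]
    [IsDomain R] {p : R[X]} (hp : p.Monic) {r : ι → R} (hr : Function.Injective r)
    (h : ∀ i, p.eval (r i) = 0) (hd : p.natDegree = Fintype.card ι) :
    p = ∏ i, (X - C (r i)) := by
  have hdvd : ∏ i, (X - C (r i)) ∣ p := by
    have := (Multiset.prod_X_sub_C_dvd_iff_le_roots hp.ne_zero (Finset.univ.val.map r)).2 <|
      (Multiset.le_iff_subset (Finset.univ.nodup.map hr)).2 fun x hx => by
        obtain ⟨i, -, rfl⟩ := Multiset.mem_map.1 hx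
        exact (mem_roots hp.ne_zero).2 (h i)
    simpa [Multiset.map_map] using this
  have hm : (∏ i, (X - C (r i))).Monic := monic_prod_of_monic _ _ fun i _ => monic_X_sub_C _
  refine eq_of_monic_of_dvd_of_natDegree_le hm hp hdvd ?_
  rw [hd, natDegree_prod_of_monic _ _ fun i _ => monic_X_sub_C _]
  simp

/-- For a root y of the auxiliary septic, the first factor in `laMacchia_incidence` is a cubic in x
dividing a nonzero multiple of f. Its three roots are roots of f, and eliminating y from their sum
and product gives the relation. -/
theorem exists_fanoRelation {L : Type*} [Field L] {b : L} (hb : b ≠ 0) {r : ZMod 7 → L}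
    (hr : Function.Injective r) (h : laMacchia b = ∏ i, (X - C (r i))) :
    ∃ i j k, i ≠ j ∧ i ≠ k ∧ j ≠ k ∧ FanoRelation b (r i) (r j) (r k) := by
  let φ := algebraMap L (AlgebraicClosure L)
  have hφ : Function.Injective φ := φ.injective
  set β := φ b with hβ
  have hβ0 : β ≠ 0 := (map_ne_zero φ).2 hb
  obtain ⟨y, hy⟩ : ∃ y : AlgebraicClosure L,
      y ^ 7 + (2 - 3 * β) * y ^ 6 + (2 * β ^ 2 + 2 * β - 3) * y ^ 5 +
      (-4 * β ^ 2 - 6 * β - 2) * y ^ 4 + (-β ^ 3 + 2 * β ^ 2 + 7 * β + 2) * y ^ 3 +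
      (β ^ 3 + 4 * β ^ 2) * y ^ 2 + (β ^ 3 - 3 * β ^ 2) * y - β ^ 3 = 0 := by
    obtain ⟨y, hy⟩ := IsAlgClosed.exists_root
      (X ^ 7 + C (2 - 3 * β) * X ^ 6 + C (2 * β ^ 2 + 2 * β - 3) * X ^ 5 +
      C (-4 * β ^ 2 - 6 * β - 2) * X ^ 4 + C (-β ^ 3 + 2 * β ^ 2 + 7 * β + 2) * X ^ 3 +
      C (β ^ 3 + 4 * β ^ 2) * X ^ 2 + C (β ^ 3 - 3 * β ^ 2) * X - C (β ^ 3)) (by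
        have : (X ^ 7 + C (2 - 3 * β) * X ^ 6 + C (2 * β ^ 2 + 2 * β - 3) * X ^ 5 +
          C (-4 * β ^ 2 - 6 * β - 2) * X ^ 4 + C (-β ^ 3 + 2 * β ^ 2 + 7 * β + 2) * X ^ 3 +
          C (β ^ 3 + 4 * β ^ 2) * X ^ 2 + C (β ^ 3 - 3 * β ^ 2) * X - C (β ^ 3)).degree = 7 := by
          compute_degree!
        rw [this]; decide)
    refine ⟨y, ?_⟩
    simpa [IsRoot] using hy
  -- The auxiliary septic takes the values -β³ at 0 and β² at 1. Excluding both makes the leading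
  -- coefficient y of the cubic and the factor y⁴ - y³ nonzero.
  have hy0 : y ≠ 0 := by
    rintro rfl
    exact pow_ne_zero 3 hβ0 (by linear_combination -hy)
  have hy1 : y ≠ 1 := by
    rintro rfl
    exact pow_ne_zero 2 hβ0 (by linear_combination hy)
  set P : Cubic (AlgebraicClosure L) :=
    ⟨y, β - (β - 1) * y - y ^ 2, y ^ 3 - (β - 1) * y ^ 2 + (2 * β - 2) * y - β,
      β * y ^ 2 - β * y⟩ with hP
  have hPa : P.a ≠ 0 := hy0
  obtain ⟨u, v, w, hroots⟩ := (Cubic.splits_iff_roots_eq_three (φ := RingHom.id _) hPa).1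
    (IsAlgClosed.splits _)
  have hsum := Cubic.b_eq_three_roots hPa hroots
  have hprod := Cubic.d_eq_three_roots hPa hroots
  simp only [RingHom.id_apply, hP] at hsum hprod
  have hPid : Cubic.map (RingHom.id (AlgebraicClosure L)) P = P := rfl
  rw [hPid] at hroots
  have hL : laMacchia β = ∏ i, (X - C (φ (r i))) := by
    have := congrArg (Polynomial.map φ) h
    rw [laMacchia_map] at this
    rw [this, Polynomial.map_prod]
    simp
  have hc : y ^ 4 - y ^ 3 ≠ 0 := by
    have : y ^ 4 - y ^ 3 = y ^ 3 * (y - 1) := by ring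
    rw [this]
    exact mul_ne_zero (pow_ne_zero _ hy0) (sub_ne_zero.2 hy1)
  have hdvd : P.toPoly ∣ C (y ^ 4 - y ^ 3) * laMacchia β := by
    have h1 : P.toPoly = X ^ 3 * C y + X * C y ^ 3 - X ^ 2 * C y ^ 2 -
        (C β - 1) * (X ^ 2 * C y + X * C y ^ 2) + C β * (X ^ 2 + C y ^ 2) +
        (2 * C β - 2) * (X * C y) - C β * (X + C y) := by
      rw [Cubic.toPoly, hP]
      simp only [C_add, C_sub, C_mul, C_pow, C_1, C_ofNat]
      ring
    have h2 := congrArg C hy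
    simp only [C_add, C_sub, C_mul, C_pow, C_neg, C_ofNat, C_0] at h2
    have h3 := laMacchia_incidence (C β) X (C y)
    rw [h1]
    refine Dvd.intro _ (h3.trans ?_)
    rw [laMacchia]
    simp only [C_add, C_sub, C_mul, C_pow, C_neg, C_ofNat]
    linear_combination (X ^ 4 - X ^ 3) * h2
  have hle : ({u, v, w} : Multiset _) ≤ Finset.univ.val.map fun i => φ (r i) := by
    have h1 := roots.le_of_dvd (mul_ne_zero (C_ne_zero.2 hc) (laMacchia_monic β).ne_zero) hdvd
    rw [roots_C_mul _ hc, hL, roots_prod _ _ (hL ▸ (laMacchia_monic β).ne_zero)] at h1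
    have : P.toPoly.roots = {u, v, w} := hroots
    rw [this] at h1
    simpa using h1
  have hnd : ({u, v, w} : Multiset (AlgebraicClosure L)).Nodup :=
    Multiset.nodup_of_le hle (Finset.univ.nodup.map (hφ.comp hr))
  have hmem : ∀ x ∈ ({u, v, w} : Multiset (AlgebraicClosure L)), ∃ i, φ (r i) = x := fun x hx => by
    simpa using Multiset.mem_map.1 (Multiset.mem_of_le hle hx)
  obtain ⟨i, rfl⟩ := hmem u (by simp)
  obtain ⟨j, rfl⟩ := hmem v (by simp)
  obtain ⟨k, rfl⟩ := hmem w (by simp)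
  simp only [Multiset.insert_eq_cons, Multiset.nodup_cons, Multiset.mem_cons,
    Multiset.mem_singleton, not_or] at hnd
  refine ⟨i, j, k, fun e => hnd.1.1 (by rw [e]), fun e => hnd.1.2 (by rw [e]),
    fun e => hnd.2.1 (by rw [e]), hφ ?_⟩
  -- Vieta for the product recovers y as 1 - xyz/β.
  have hz : β - φ (r i) * φ (r j) * φ (r k) = β * y := by
    refine mul_left_cancel₀ hy0 ?_
    linear_combination -hprod
  simp only [map_mul, map_add, map_sub, map_pow, map_one, ← hβ]
  rw [hz]
  linear_combination β ^ 2 * hsum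

/-- The 35 - 7 = 28 triangles form four free orbits under translation. -/
theorem fano_triangle_representatives (i j k : ZMod 7) : i ≠ j → i ≠ k → j ≠ k →
    fanoThird i j ≠ k → ∃ s, [0, 1, 2].Perm [i + s, j + s, k + s] ∨
      [0, 2, 4].Perm [i + s, j + s, k + s] ∨ [0, 3, 6].Perm [i + s, j + s, k + s] ∨
      [0, 1, 3].Perm [i + s, j + s, k + s] := by
  revert i j k; decide +kernel

theorem fano_line_transitive (i j a b : ZMod 7) : i ≠ j → a ≠ b →
    ∃ s, [a, b, fanoThird a b].Perm [i + s, j + s, fanoThird i j + s] := by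
  revert i j a b; decide +kernel

/-- A translation invariant symmetric ternary relation on `ZMod 7` which holds for some triple of
distinct points and fails for representatives of the triangles is collinearity. -/
theorem fanoThird_eq_iff_of_invariant {S : ZMod 7 → ZMod 7 → ZMod 7 → Prop}
    (hswap : ∀ i j k, S i j k → S j i k) (hrot : ∀ i j k, S i j k → S j k i)
    (hadd : ∀ i j k, S i j k → S (i + 1) (j + 1) (k + 1))
    (h1 : ¬ S 0 1 2) (h2 : ¬ S 0 2 4) (h3 : ¬ S 0 3 6) (h4 : ¬ S 0 1 3)
    (hex : ∃ i j k, i ≠ j ∧ i ≠ k ∧ j ≠ k ∧ S i j k)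
    {i j k : ZMod 7} (hij : i ≠ j) (hik : i ≠ k) (hjk : j ≠ k) :
    S i j k ↔ fanoThird i j = k := by
  have haddn : ∀ (s i j k : ZMod 7), S i j k → S (i + s) (j + s) (k + s) := by
    intro s i j k h
    have : ∀ n : ℕ, S (i + n) (j + n) (k + n) := by
      intro n
      induction n with
      | zero => simpa using h
      | succ n ih => simpa [add_assoc] using hadd _ _ _ ih
    simpa using this s.val
  have hperm : ∀ {i j k a b c : ZMod 7}, [a, b, c].Perm [i, j, k] → S i j k → S a b c := by
    intro i j k a b c hl h
    have := List.mem_permutations.2 hl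
    simp only [List.permutations, List.permutationsAux, List.permutationsAux.rec,
      List.mem_cons, List.cons.injEq] at this
    simp at this
    rcases this with h' | h' | h' | h' | h' | h' <;> obtain ⟨rfl, rfl, rfl⟩ := h'
    · exact h
    · exact hswap _ _ _ h
    · exact hswap _ _ _ (hrot _ _ _ h)
    · exact hrot _ _ _ h
    · exact hrot _ _ _ (hrot _ _ _ h)
    · exact hswap _ _ _ (hrot _ _ _ (hrot _ _ _ h))
  have hline : ∀ {i j k : ZMod 7}, i ≠ j → i ≠ k → j ≠ k → S i j k → fanoThird i j = k := by
    intro i j k hij hik hjk h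
    by_contra hne
    obtain ⟨s, hs | hs | hs | hs⟩ := fano_triangle_representatives i j k hij hik hjk hne
    · exact h1 (hperm hs (haddn s _ _ _ h))
    · exact h2 (hperm hs (haddn s _ _ _ h))
    · exact h3 (hperm hs (haddn s _ _ _ h))
    · exact h4 (hperm hs (haddn s _ _ _ h))
  refine ⟨hline hij hik hjk, ?_⟩
  rintro rfl
  obtain ⟨a, b, c, hab, hac, hbc, h⟩ := hex
  obtain rfl := hline hab hac hbc h
  obtain ⟨s, hs⟩ := fano_line_transitive a b i j hab hij
  exact hperm hs (haddn s _ _ _ h)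

theorem fanoThird_ne {i j : ZMod 7} (h : i ≠ j) : i ≠ fanoThird i j ∧ j ≠ fanoThird i j := by
  revert i j; decide

theorem fanoThird_self (i : ZMod 7) : fanoThird i i = i := by
  revert i; decide

theorem ZMod.val_add_one_seven (i : ZMod 7) :
    (i.val = 6 ∧ (i + 1).val = 0) ∨ (i + 1).val = i.val + 1 := by
  revert i; decide

/-! ### Residue fields and the labelling of the roots -/

section Residue

universe u

variable (K : Type u) [Field K]

/-- Residue fields of a number field as abstract fields. -/
theorem NumberField.exists_residueField (P : Ideal (𝓞 K)) (hP : P.IsMaximal) (p : ℕ)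
    [Fact p.Prime] (hp : (p : 𝓞 K) ∈ P) :
    ∃ (k : Type u) (_ : Field k) (_ : CharP k p) (π : 𝓞 K →+* k), RingHom.ker π = P := by
  refine ⟨𝓞 K ⧸ P, Ideal.Quotient.field P, ?_, Ideal.Quotient.mk P, Ideal.mk_ker⟩
  have := hP.isPrime
  exact (CharP.charP_iff_prime_eq_zero Fact.out).2
    (by simpa using Ideal.Quotient.eq_zero_iff_mem.2 hp)

theorem NumberField.exists_frobenius_residueField [NumberField K] [IsGalois ℚ K] (p : ℕ)
    [Fact p.Prime] :
    ∃ (k : Type u) (_ : Field k) (_ : CharP k p) (π : 𝓞 K →+* k) (φ : K ≃ₐ[ℚ] K),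
      ∀ x, π (φ • x) = π x ^ p := by
  obtain ⟨P, hP, hpP, φ, hφ⟩ := NumberField.exists_frobenius K p
  obtain ⟨k, hk, hchar, π, hker⟩ := NumberField.exists_residueField K P hP p hpP
  refine ⟨k, hk, hchar, π, φ, fun x => ?_⟩
  rw [← map_pow, ← sub_eq_zero, ← map_sub, ← RingHom.mem_ker, hker]
  exact hφ x

end Residue

section Labelling

variable {K : Type*} [Field K]

theorem laMacchia_eval_smul {R G : Type*} [CommRing R] [Group G] [MulSemiringAction G R] (σ : G)
    {b : ℤ} {x : R} (h : (laMacchia (b : R)).eval x = 0) :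
    (laMacchia (b : R)).eval (σ • x) = 0 := by
  have := congrArg (MulSemiringAction.toRingHom G R σ) h
  rw [laMacchia_eval] at this ⊢
  simpa only [map_add, map_sub, map_mul, map_pow, map_neg, map_ofNat, map_intCast, map_zero,
    MulSemiringAction.toRingHom_apply] using this

theorem laMacchia_exists_root {b : ℤ} (hs : (laMacchia (b : K)).Splits) :
    ∃ x : 𝓞 K, (laMacchia (b : 𝓞 K)).eval x = 0 := by
  obtain ⟨x, hx⟩ := hs.exists_eval_eq_zero (by
    rw [degree_eq_natDegree (laMacchia_monic _).ne_zero, laMacchia_natDegree]; decide)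
  have hint : IsIntegral ℤ x := ⟨laMacchia b, laMacchia_monic b, by
    rw [eval₂_eq_eval_map, laMacchia_map]; simpa using hx⟩
  obtain ⟨y, rfl⟩ : ∃ y : 𝓞 K, (y : K) = x := ⟨⟨x, hint⟩, rfl⟩
  refine ⟨y, NumberField.RingOfIntegers.ext ?_⟩
  rw [laMacchia_eval] at hx ⊢
  push_cast
  exact hx

/-- The roots can be labelled by the points of the Fano plane so that the Frobenius at `2` is a
translation and collinearity is an algebraic relation. -/
theorem laMacchia_exists_labelling [NumberField K] [IsGalois ℚ K] {b : ℤ}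
    (hs : (laMacchia (b : K)).Splits)
    (hb : Odd b) :
    ∃ r : ZMod 7 → 𝓞 K, Function.Injective r ∧
      laMacchia (b : 𝓞 K) = ∏ i, (X - C (r i)) ∧
      (∃ φ : K ≃ₐ[ℚ] K, ∀ i, r (i + 1) = φ • r i) ∧
      ∀ i j k, i ≠ j → i ≠ k → j ≠ k → (FanoRelation (b : 𝓞 K) (r i) (r j) (r k) ↔
        fanoThird i j = k) := by
  obtain ⟨x, hx⟩ := laMacchia_exists_root hs
  obtain ⟨k, _, _, π, φ, hfrob⟩ := NumberField.exists_frobenius_residueField K 2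
  have h2 : (2 : k) = 0 := CharTwo.two_eq_zero
  have hb1 : π (b : 𝓞 K) = 1 := by
    obtain ⟨c, rfl⟩ := hb
    simp only [map_intCast]
    push_cast
    rw [h2]
    ring
  have hroot : (laMacchia (1 : k)).eval (π x) = 0 := by
    rw [← hb1, ← laMacchia_map, Polynomial.eval_map_apply, hx, map_zero]
  have hpow : ∀ n : ℕ, π (φ ^ n • x) = π x ^ 2 ^ n := by
    intro n
    induction n with
    | zero => simp
    | succ n ih => rw [pow_succ', mul_smul, hfrob, ih, ← pow_mul, pow_succ]
  set r : ZMod 7 → 𝓞 K := fun i => φ ^ i.val • x with hr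
  have hπr : ∀ i, π (r i) = π x ^ 2 ^ i.val := fun i => hpow _
  have hinj' : Function.Injective fun i => π (r i) := by
    simp only [hπr]
    exact laMacchia_conjugates_injective hroot
  have hinj : Function.Injective r := fun i j h => hinj' (by simp only [h])
  have heval : ∀ i, (laMacchia (b : 𝓞 K)).eval (r i) = 0 := fun i => laMacchia_eval_smul _ hx
  have hprod : laMacchia (b : 𝓞 K) = ∏ i, (X - C (r i)) :=
    (laMacchia_monic _).eq_prod_X_sub_C_of_injective hinj heval
      (by rw [laMacchia_natDegree, ZMod.card])
  -- Only the wrap-around from 6 to 0 is not built into the definition of `r`. There `x ^ 128 = x`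
  -- gives equality after reduction, which is injective on the roots.
  have hstep : ∀ i, r (i + 1) = φ • r i := by
    intro i
    obtain ⟨j, hj⟩ := Polynomial.exists_eq_of_eval_prod_X_sub_C_eq_zero
      (ρ := r) (by rw [← hprod]; exact laMacchia_eval_smul φ (heval i))
    have : j = i + 1 := by
      apply hinj'
      simp only
      rw [hj, hfrob, hπr, hπr, ← pow_mul, ← pow_succ]
      have h128 := (laMacchia_root_pow hroot).2.2.2.2
      generalize π x = ξ at h128
      rcases ZMod.val_add_one_seven i with ⟨hi, h0⟩ | hi
      · rw [hi, h0, pow_zero, pow_one]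
        exact h128
      · rw [hi]
    rw [← this, hj]
  refine ⟨r, hinj, hprod, ⟨φ, hstep⟩, fun i j k hij hik hjk => ?_⟩
  have hnot := laMacchia_not_fanoRelation hroot
  have hred : ∀ i j k, FanoRelation (b : 𝓞 K) (r i) (r j) (r k) →
      FanoRelation 1 (π x ^ 2 ^ i.val) (π x ^ 2 ^ j.val) (π x ^ 2 ^ k.val) := by
    intro i j k h
    have := h.map π
    rwa [hb1, hπr, hπr, hπr] at this
  refine fanoThird_eq_iff_of_invariant
    (S := fun i j k => FanoRelation (b : 𝓞 K) (r i) (r j) (r k))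
    (fun _ _ _ h => h.swap) (fun _ _ _ h => h.rotate)
    (fun i j k h => ?_) (fun h => hnot.1 ?_) (fun h => hnot.2.1 ?_) (fun h => hnot.2.2.1 ?_)
    (fun h => hnot.2.2.2 ?_) ?_ hij hik hjk
  · have := h.map (MulSemiringAction.toRingHom _ (𝓞 K) φ)
    simpa [hstep] using this
  · have : FanoRelation 1 (π x ^ 2 ^ 0) (π x ^ 2 ^ 1) (π x ^ 2 ^ 2) := hred 0 1 2 h
    norm_num at this
    exact this
  · have : FanoRelation 1 (π x ^ 2 ^ 0) (π x ^ 2 ^ 2) (π x ^ 2 ^ 4) := hred 0 2 4 h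
    norm_num at this
    exact this
  · have : FanoRelation 1 (π x ^ 2 ^ 0) (π x ^ 2 ^ 3) (π x ^ 2 ^ 6) := hred 0 3 6 h
    norm_num at this
    exact this
  · have : FanoRelation 1 (π x ^ 2 ^ 0) (π x ^ 2 ^ 1) (π x ^ 2 ^ 3) := hred 0 1 3 h
    norm_num at this
    exact this
  · have hb0 : (b : K) ≠ 0 := by
      have : b ≠ 0 := by rintro rfl; simp at hb
      exact_mod_cast this
    obtain ⟨i, j, k, h1, h2, h3, h⟩ := exists_fanoRelation (r := fun i => (r i : K)) hb0
      (fun i j h => hinj (NumberField.RingOfIntegers.ext h)) (by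
        have := congrArg (Polynomial.map (algebraMap (𝓞 K) K)) hprod
        rw [laMacchia_map, Polynomial.map_prod] at this
        simpa using this)
    refine ⟨i, j, k, h1, h2, h3, ?_⟩
    unfold FanoRelation at h ⊢
    apply NumberField.RingOfIntegers.ext
    push_cast
    exact h

end Labelling

/-! ### Determination of the Galois group -/

section Group

variable {b : ℤ}

theorem Int.cast_eq_of_emod_eq {k : Type*} [CommRing k] {p : ℕ} [CharP k p] {b c : ℤ}
    (h : b % p = c) : (b : k) = c := by
  have h1 := Int.emod_add_mul_ediv b p
  rw [h] at h1
  rw [← h1]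
  simp

theorem laMacchia_map_prod {A k : Type*} [CommRing A] [CommRing k] {r : ZMod 7 → A} (π : A →+* k)
    (h : laMacchia (b : A) = ∏ i, (X - C (r i))) :
    laMacchia (b : k) = ∏ i, (X - C (π (r i))) := by
  have := congrArg (Polynomial.map π) h
  rw [laMacchia_map, Polynomial.map_prod] at this
  simpa using this

theorem laMacchia_exists_quadratic_root {k : Type*} [Field k] [CharP k 5]
    (h : (laMacchia (4 : k)).Splits) :
    ∃ x : k, (laMacchia (4 : k)).eval x = 0 ∧ x ^ 2 + 4 * x + 1 = 0 := by
  have h5 : (5 : k[X]) = 0 := by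
    have : ((5 : ℕ) : k[X]) = 0 := CharP.cast_eq_zero _ 5
    exact_mod_cast this
  have hdvd : (X ^ 2 + C 4 * X + 1 : k[X]) ∣ laMacchia (4 : k) := by
    refine Dvd.intro (X ^ 5 + X ^ 4 + 2 * X ^ 3 - X ^ 2 + 2 * X + 1) ?_
    rw [laMacchia]
    simp only [C_add, C_sub, C_mul, C_pow, C_neg, C_ofNat]
    linear_combination (-(-3 * X ^ 6 + 6 * X ^ 5 - 2 * X ^ 4 - 18 * X ^ 3 + 24 * X ^ 2 +
      2 * X - 13)) * h5
  obtain ⟨x, hx⟩ := (h.of_dvd (laMacchia_monic _).ne_zero hdvd).exists_eval_eq_zero (by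
    have : (X ^ 2 + C 4 * X + 1 : k[X]).degree = 2 := by compute_degree!
    rw [this]; decide)
  refine ⟨x, ?_, by simpa using hx⟩
  obtain ⟨q, hq⟩ := hdvd
  rw [hq, eval_mul, hx, zero_mul]

variable {K : Type*} [Field K] [NumberField K] [IsGalois ℚ K] {r : ZMod 7 → 𝓞 K}

/-- Modulo 5 the septic has the factor X² + 4X + 1, whose roots ξ and 1 - ξ are interchanged by
Frobenius. An element of odd order cannot do this, since ξ = 1 - ξ contradicts the quadratic. -/
theorem laMacchia_two_dvd_card (h : laMacchia (b : 𝓞 K) = ∏ i, (X - C (r i)))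
    (hb : b % 5 = 4) : 2 ∣ Nat.card (K ≃ₐ[ℚ] K) := by
  have := Fact.mk (by norm_num : Nat.Prime 5)
  obtain ⟨k, _, _, π, φ, hfrob⟩ := NumberField.exists_frobenius_residueField K 5
  have h5 : (5 : k) = 0 := by
    have : ((5 : ℕ) : k) = 0 := CharP.cast_eq_zero _ 5
    exact_mod_cast this
  have hp := laMacchia_map_prod π h
  rw [Int.cast_eq_of_emod_eq (k := k) (p := 5) hb, Int.cast_ofNat] at hp
  obtain ⟨ξ, hξ, hq⟩ := laMacchia_exists_quadratic_root (k := k)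
    (by rw [hp]; exact Splits.prod fun i _ => Splits.X_sub_C _)
  obtain ⟨i, rfl⟩ := Polynomial.exists_eq_of_eval_prod_X_sub_C_eq_zero (hp ▸ hξ)
  set ξ := π (r i)
  have hpow : ∀ n : ℕ, π (φ ^ n • r i) = ξ ^ 5 ^ n := by
    intro n
    induction n with
    | zero => simp [ξ]
    | succ n ih => rw [pow_succ', mul_smul, hfrob, ih, ← pow_mul, pow_succ]
  have h5' : ξ ^ 5 = 1 - ξ := by
    linear_combination (ξ ^ 3 - 4 * ξ ^ 2 + 15 * ξ - 56) * hq + (42 * ξ + 11) * h5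
  have h25 : ξ ^ 25 = ξ := by
    have : ξ ^ 25 = (ξ ^ 5) ^ 5 := by ring
    rw [this, h5']
    linear_combination -h5' + (-ξ + 2 * ξ ^ 2 - 2 * ξ ^ 3 + ξ ^ 4) * h5
  have hodd : ∀ n, ξ ^ 5 ^ (2 * n + 1) = ξ ^ 5 := by
    intro n
    induction n with
    | zero => simp
    | succ n ih =>
      have : 5 ^ (2 * (n + 1) + 1) = 5 ^ (2 * n + 1) * 25 := by ring
      rw [this, pow_mul, ih, ← pow_mul, mul_comm 5 25, pow_mul, h25]
  by_contra h2
  obtain ⟨n, hn⟩ : Odd (orderOf φ) := by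
    rw [← Nat.not_even_iff_odd]
    exact fun he => h2 (he.two_dvd.trans (orderOf_dvd_natCard φ))
  have := hpow (orderOf φ)
  rw [pow_orderOf_eq_one, one_smul, hn, hodd, h5'] at this
  have h2ξ : 2 * ξ = 1 := by linear_combination this
  refine one_ne_zero (α := k) ?_
  linear_combination 8 * hq - (4 * ξ + 18) * h2ξ - 5 * h5

/-- The Galois group acts on the seven roots as the collineation group of the Fano plane. -/
theorem laMacchia_exists_permHom [IsSplittingField ℚ K (laMacchia (b : ℚ))] (ho : Odd b)
    (h5 : b % 5 = 4) :
    ∃ r : ZMod 7 → 𝓞 K, Function.Injective r ∧ laMacchia (b : 𝓞 K) = ∏ i, (X - C (r i)) ∧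
      ∃ Φ : (K ≃ₐ[ℚ] K) →* Perm (ZMod 7), Function.Injective Φ ∧ Φ.range = fanoAut ∧
        ∀ σ i, r (Φ σ i) = σ • r i := by
  have hs : (laMacchia (b : K)).Splits := by
    have := IsSplittingField.splits K (laMacchia (b : ℚ))
    rw [laMacchia_map] at this
    simpa using this
  obtain ⟨r, hr, hprod, ⟨φ, hφ⟩, hfano⟩ := laMacchia_exists_labelling hs ho
  obtain ⟨Φ, hΦ⟩ := MulAction.exists_permHom (G := K ≃ₐ[ℚ] K) hr fun σ i =>
    Polynomial.exists_eq_of_eval_prod_X_sub_C_eq_zero (ρ := r) (by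
      rw [← hprod]
      refine laMacchia_eval_smul σ ?_
      rw [hprod, eval_prod]
      exact Finset.prod_eq_zero (Finset.mem_univ i) (by simp))
  have hinj : Function.Injective Φ := by
    rw [injective_iff_map_eq_one]
    intro σ hσ
    have hfix : ∀ i, σ • r i = r i := fun i => by rw [← hΦ, hσ, Perm.one_apply]
    apply AlgEquiv.coe_toAlgHom_injective
    refine AlgHom.ext_of_adjoin_eq_top
      (IsSplittingField.adjoin_rootSet K (laMacchia (b : ℚ))) fun y hy => ?_
    have hy0 : (laMacchia (b : K)).eval y = 0 := by
      have := (mem_rootSet.1 hy).2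
      rw [aeval_def, eval₂_eq_eval_map, laMacchia_map] at this
      simpa using this
    rw [laMacchia_map_prod (algebraMap (𝓞 K) K) hprod] at hy0
    obtain ⟨i, rfl⟩ := Polynomial.exists_eq_of_eval_prod_X_sub_C_eq_zero hy0
    have := congrArg (algebraMap (𝓞 K) K) (hfix i)
    exact this
  have hle : Φ.range ≤ fanoAut := by
    rintro _ ⟨σ, rfl⟩ i j
    rcases eq_or_ne i j with rfl | hij
    · rw [fanoThird_self, fanoThird_self]
    have hij' : Φ σ i ≠ Φ σ j := (Φ σ).injective.ne hij
    obtain ⟨hik, hjk⟩ := fanoThird_ne hij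
    have hrel := ((hfano i j _ hij hik hjk).2 rfl).map (MulSemiringAction.toRingHom _ (𝓞 K) σ)
    simp only [MulSemiringAction.toRingHom_apply, map_intCast, ← hΦ] at hrel
    exact ((hfano _ _ _ hij' ((Φ σ).injective.ne hik) ((Φ σ).injective.ne hjk)).1 hrel).symm
  have hrot : fanoRot ∈ Φ.range := ⟨φ, by
    ext1 i
    apply hr
    rw [hΦ, ← hφ]
    rfl⟩
  refine ⟨r, hr, hprod, Φ, hinj, eq_fanoAut_of_two_dvd_card hle hrot ?_, hΦ⟩
  rw [← Nat.card_congr (MonoidHom.ofInjective hinj).toEquiv]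
  exact laMacchia_two_dvd_card hprod h5

end Group

/-! ### Bounding the coincidences modulo p -/

section Certificates

variable {A : Type*} [CommRing A]

theorem laMacchia_expand (b : A) : laMacchia b =
    X ^ 7 + (2 - 3 * C b) * X ^ 6 + (2 * C b ^ 2 + 2 * C b - 3) * X ^ 5 +
    (-3 * C b ^ 2 + 12 * C b - 2) * X ^ 4 + (-C b ^ 3 + C b ^ 2 - 11 * C b + 2) * X ^ 3 +
    (C b ^ 3 + 4 * C b ^ 2) * X ^ 2 + (C b ^ 3 - 3 * C b ^ 2) * X - C b ^ 3 := by
  simp only [laMacchia, C_add, C_sub, C_mul, C_pow, C_neg, C_ofNat]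

theorem laMacchia_derivative_expand (b : A) : derivative (laMacchia b) =
    7 * X ^ 6 + 6 * (2 - 3 * C b) * X ^ 5 + 5 * (2 * C b ^ 2 + 2 * C b - 3) * X ^ 4 +
    4 * (-3 * C b ^ 2 + 12 * C b - 2) * X ^ 3 +
    3 * (-C b ^ 3 + C b ^ 2 - 11 * C b + 2) * X ^ 2 +
    2 * (C b ^ 3 + 4 * C b ^ 2) * X + (C b ^ 3 - 3 * C b ^ 2) := by
  simp only [laMacchia_derivative, C_add, C_sub, C_mul, C_pow, C_neg, C_ofNat]

/-- This and the next identity are combinations U f + V f' of degree at most two in x. Such a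
combination, if nonzero, leaves at least 7 - 2 distinct roots; two are used because one alone may
vanish for special b. -/
theorem laMacchia_first_combination (b x : A) :
    ((-14 * b ^ 7 - 61 * b ^ 6 - 4384 * b ^ 5 - 8350 * b ^ 4 + 16999 * b ^ 3 + 12361 * b ^ 2 - 2142
    * b + 72) + (444 * b ^ 7 - 1069 * b ^ 6 - 2208 * b ^ 5 + 12558 * b ^ 4 + 14723 * b ^ 3 - 26919 *
    b ^ 2 - 13050 * b + 3408) * x + (836 * b ^ 6 - 6890 * b ^ 5 + 25698 * b ^ 4 - 59412 * b ^ 3 +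
    11938 * b ^ 2 + 32672 * b - 4852) * x ^ 2 + (-1480 * b ^ 6 + 2322 * b ^ 5 - 7298 * b ^ 4 - 10712
    * b ^ 3 + 33286 * b ^ 2 - 3982 * b - 8616) * x ^ 3 + (2664 * b ^ 5 - 6232 * b ^ 4 + 15779 * b ^
    3 - 8241 * b ^ 2 - 13998 * b + 7092) * x ^ 4 + (-1036 * b ^ 4 + 1477 * b ^ 3 - 4697 * b ^ 2 +
    392 * b + 4088) * x ^ 5) * (x ^ 7 + (2 - 3 * b) * x ^ 6 + (2 * b ^ 2 + 2 * b - 3) * x ^ 5 + (-3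
    * b ^ 2 + 12 * b - 2) * x ^ 4 + (-b ^ 3 + b ^ 2 - 11 * b + 2) * x ^ 3 + (b ^ 3 + 4 * b ^ 2) * x
    ^ 2 + (b ^ 3 - 3 * b ^ 2) * x - b ^ 3) + ((130 * b ^ 7 - 441 * b ^ 6 + 86 * b ^ 5 - 382 * b ^ 4
    + 590 * b ^ 3 + 1302 * b ^ 2 + 36 * b) + (54 * b ^ 7 + 278 * b ^ 6 + 490 * b ^ 5 + 5036 * b ^ 4
    - 6313 * b ^ 3 - 4979 * b ^ 2 + 762 * b - 24) * x + (-148 * b ^ 7 + 301 * b ^ 6 - 245 * b ^ 5 -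
    1248 * b ^ 4 - 7386 * b ^ 3 + 8193 * b ^ 2 + 4746 * b - 1144) * x ^ 2 + (-256 * b ^ 6 + 1927 * b
    ^ 5 - 6036 * b ^ 4 + 12949 * b ^ 3 - 1678 * b ^ 2 - 8072 * b + 1204) * x ^ 3 + (296 * b ^ 6 -
    408 * b ^ 5 + 1277 * b ^ 4 + 2065 * b ^ 3 - 5984 * b ^ 2 + 458 * b + 1728) * x ^ 4 + (-444 * b ^
    5 + 1023 * b ^ 4 - 2602 * b ^ 3 + 1393 * b ^ 2 + 2234 * b - 1180) * x ^ 5 + (148 * b ^ 4 - 211 *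
    b ^ 3 + 671 * b ^ 2 - 56 * b - 584) * x ^ 6) * (7 * x ^ 6 + 6 * (2 - 3 * b) * x ^ 5 + 5 * (2 * b
    ^ 2 + 2 * b - 3) * x ^ 4 + 4 * (-3 * b ^ 2 + 12 * b - 2) * x ^ 3 + 3 * (-b ^ 3 + b ^ 2 - 11 * b
    + 2) * x ^ 2 + 2 * (b ^ 3 + 4 * b ^ 2) * x + (b ^ 3 - 3 * b ^ 2)) = (144 * b ^ 10 - 770 * b ^ 9
    + 5793 * b ^ 8 + 7710 * b ^ 7 - 15263 * b ^ 6 - 12829 * b ^ 5 - 1728 * b ^ 4 - 180 * b ^ 3) +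
    (-144 * b ^ 10 + 1324 * b ^ 9 - 5693 * b ^ 8 - 4266 * b ^ 7 + 4029 * b ^ 6 + 9567 * b ^ 5 + 12 *
    b ^ 4 + 1068 * b ^ 3 - 144 * b ^ 2) * x + (92 * b ^ 9 - 554 * b ^ 8 - 2186 * b ^ 7 + 35680 * b ^
    6 - 21794 * b ^ 5 + 6232 * b ^ 4 - 9738 * b ^ 3 - 72 * b ^ 2 + 216 * b) * x ^ 2 := by
  ring

theorem laMacchia_second_combination (b x : A) :
    ((-55 * b ^ 7 + 515 * b ^ 6 - 7270 * b ^ 5 - 28385 * b ^ 4 + 3048 * b ^ 3 - 32527 * b ^ 2 + 4158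
    * b - 72) + (429 * b ^ 7 + 897 * b ^ 6 - 2314 * b ^ 5 - 1401 * b ^ 4 + 28536 * b ^ 3 - 1971 * b
    ^ 2 + 41514 * b - 7872) * x + (946 * b ^ 6 - 3884 * b ^ 5 + 2054 * b ^ 4 - 62740 * b ^ 3 + 77140
    * b ^ 2 - 82224 * b + 10804) * x ^ 2 + (-1430 * b ^ 6 - 4684 * b ^ 5 - 9682 * b ^ 4 - 450 * b ^
    3 - 6620 * b ^ 2 - 15926 * b + 19776) * x ^ 3 + (2574 * b ^ 5 + 6097 * b ^ 4 + 13602 * b ^ 3 -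
    34827 * b ^ 2 + 42942 * b - 16020) * x ^ 4 + (-1001 * b ^ 4 - 3248 * b ^ 3 - 8435 * b ^ 2 + 7308
    * b - 9296) * x ^ 5) * (x ^ 7 + (2 - 3 * b) * x ^ 6 + (2 * b ^ 2 + 2 * b - 3) * x ^ 5 + (-3 * b
    ^ 2 + 12 * b - 2) * x ^ 4 + (-b ^ 3 + b ^ 2 - 11 * b + 2) * x ^ 3 + (b ^ 3 + 4 * b ^ 2) * x ^ 2
    + (b ^ 3 - 3 * b ^ 2) * x - b ^ 3) + ((121 * b ^ 7 + 159 * b ^ 6 - 90 * b ^ 5 - 4780 * b ^ 4 +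
    808 * b ^ 3 - 2898 * b ^ 2 - 36 * b) + (66 * b ^ 7 + 346 * b ^ 6 + 2742 * b ^ 5 + 9129 * b ^ 4 -
    3080 * b ^ 3 + 12797 * b ^ 2 - 1434 * b + 24) * x + (-143 * b ^ 7 - 354 * b ^ 6 - 527 * b ^ 5 +
    454 * b ^ 4 - 10999 * b ^ 3 + 3741 * b ^ 2 - 14458 * b + 2632) * x ^ 2 + (-275 * b ^ 6 + 901 * b
    ^ 5 + 379 * b ^ 4 + 15471 * b ^ 3 - 19648 * b ^ 2 + 20208 * b - 2692) * x ^ 3 + (286 * b ^ 6 +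
    983 * b ^ 5 + 2082 * b ^ 4 - 235 * b ^ 3 + 538 * b ^ 2 + 3658 * b - 3960) * x ^ 4 + (-429 * b ^
    5 - 1029 * b ^ 4 - 2327 * b ^ 3 + 5767 * b ^ 2 - 7002 * b + 2668) * x ^ 5 + (143 * b ^ 4 + 464 *
    b ^ 3 + 1205 * b ^ 2 - 1044 * b + 1328) * x ^ 6) * (7 * x ^ 6 + 6 * (2 - 3 * b) * x ^ 5 + 5 * (2
    * b ^ 2 + 2 * b - 3) * x ^ 4 + 4 * (-3 * b ^ 2 + 12 * b - 2) * x ^ 3 + 3 * (-b ^ 3 + b ^ 2 - 11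
    * b + 2) * x ^ 2 + 2 * (b ^ 3 + 4 * b ^ 2) * x + (b ^ 3 - 3 * b ^ 2)) = (176 * b ^ 10 - 719 * b
    ^ 9 + 6703 * b ^ 8 + 23875 * b ^ 7 + 12100 * b ^ 6 + 27205 * b ^ 5 + 4500 * b ^ 4 + 180 * b ^ 3)
    + (-176 * b ^ 10 + 1217 * b ^ 9 - 3705 * b ^ 8 - 14551 * b ^ 7 - 7424 * b ^ 6 - 16995 * b ^ 5 -
    2856 * b ^ 4 - 636 * b ^ 3 + 144 * b ^ 2) * x + (140 * b ^ 9 - 790 * b ^ 8 - 2200 * b ^ 7 +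
    26658 * b ^ 6 + 20956 * b ^ 5 + 13598 * b ^ 4 + 8298 * b ^ 3 - 576 * b ^ 2 - 216 * b) * x ^ 2 :=
    by
  ring

end Certificates

/-- In characteristic different from `2`, `3`, `7` and for `b` nonzero, at most two coincidences
occur among the roots. -/
theorem laMacchia_five_le_card {k : Type*} [Field k] [DecidableEq k] {b : k} (hb : b ≠ 0)
    (h2 : (2 : k) ≠ 0) (h3 : (3 : k) ≠ 0) (h7 : (7 : k) ≠ 0) {ρ : ZMod 7 → k}
    (h : laMacchia b = ∏ i, (X - C (ρ i))) : 5 ≤ (Finset.univ.image ρ).card := by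
  have key : ∀ (U V : k[X]) (c d e : k),
      U * laMacchia b + V * derivative (laMacchia b) = C c + C d * X + C e * X ^ 2 →
      5 ≤ (Finset.univ.image ρ).card ∨ (c = 0 ∧ d = 0 ∧ e = 0) := by
    intro U V c d e hE
    by_cases h0 : C c + C d * X + C e * X ^ 2 = 0
    · right
      refine ⟨?_, ?_, ?_⟩
      · simpa using congrArg (coeff · 0) h0
      · simpa [coeff_X, coeff_C] using congrArg (coeff · 1) h0
      · simpa [coeff_X, coeff_C] using congrArg (coeff · 2) h0
    · left
      rw [h] at hE
      have hc := Polynomial.card_le_natDegree_add_card_image h0 hE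
      have hd : (C c + C d * X + C e * X ^ 2).natDegree ≤ 2 := by compute_degree
      rw [ZMod.card] at hc
      omega
  rcases key _ _
      (144 * b ^ 10 - 770 * b ^ 9 + 5793 * b ^ 8 + 7710 * b ^ 7 - 15263 * b ^ 6 - 12829 * b ^ 5 -
      1728 * b ^ 4 - 180 * b ^ 3) (-144 * b ^ 10 + 1324 * b ^ 9 - 5693 * b ^ 8 - 4266 * b ^ 7 + 4029
      * b ^ 6 + 9567 * b ^ 5 + 12 * b ^ 4 + 1068 * b ^ 3 - 144 * b ^ 2) (92 * b ^ 9 - 554 * b ^ 8 -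
      2186 * b ^ 7 + 35680 * b ^ 6 - 21794 * b ^ 5 + 6232 * b ^ 4 - 9738 * b ^ 3 - 72 * b ^ 2 + 216
      * b)
      (by
        rw [laMacchia_derivative_expand, laMacchia_expand]
        refine (laMacchia_first_combination (C b) X).trans ?_
        simp only [C_add, C_sub, C_mul, C_pow, C_neg, C_ofNat])
    with h5 | ⟨e00, e01, e02⟩
  · exact h5
  rcases key _ _
      (176 * b ^ 10 - 719 * b ^ 9 + 6703 * b ^ 8 + 23875 * b ^ 7 + 12100 * b ^ 6 + 27205 * b ^ 5 +
      4500 * b ^ 4 + 180 * b ^ 3) (-176 * b ^ 10 + 1217 * b ^ 9 - 3705 * b ^ 8 - 14551 * b ^ 7 -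
      7424 * b ^ 6 - 16995 * b ^ 5 - 2856 * b ^ 4 - 636 * b ^ 3 + 144 * b ^ 2) (140 * b ^ 9 - 790 *
      b ^ 8 - 2200 * b ^ 7 + 26658 * b ^ 6 + 20956 * b ^ 5 + 13598 * b ^ 4 + 8298 * b ^ 3 - 576 * b
      ^ 2 - 216 * b)
      (by
        rw [laMacchia_derivative_expand, laMacchia_expand]
        refine (laMacchia_second_combination (C b) X).trans ?_
        simp only [C_add, C_sub, C_mul, C_pow, C_neg, C_ofNat])
    with h5 | ⟨e10, e11, e12⟩
  · exact h5
  -- The six coefficients of the two combinations generate an ideal containing this number, so they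
  -- cannot all vanish.
  have hne : (2 : k) ^ 7 * 3 ^ 4 * 7 ^ 12 * b ^ 4 ≠ 0 :=
    mul_ne_zero (mul_ne_zero (mul_ne_zero (pow_ne_zero _ h2) (pow_ne_zero _ h3))
      (pow_ne_zero _ h7)) (pow_ne_zero _ hb)
  refine absurd ?_ hne
  linear_combination
    (3524490791 * b ^ 2 + 5097154844 * b + 19781458662) * e00 + (9046014607 * b ^ 2 + 42771397804 *
    b) * e01 + (3483514644 * b ^ 3 + 17157466762 * b ^ 2) * e02 + (2396365315 * b ^ 2 - 20114021563
    * b + 23966007132) * e10 + (4554001459 * b ^ 2 - 26093063009 * b) * e11 + (6102571740 * b ^ 3 -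
    25265050055 * b ^ 2) * e12

/-! ### Separability at 2, 3, 5 and 7: the residues are those of 79, the certificates Bézout
identities for f and f' -/

section Separability

variable {k : Type*} [Field k] {b : ℤ} {x : k}

theorem laMacchia_separable_two [CharP k 2] (hb : b % 2 = 1)
    (h : (laMacchia (b : k)).eval x = 0) : (derivative (laMacchia (b : k))).eval x ≠ 0 := by
  intro h'
  have h2 : ((2 : ℕ) : k) = 0 := CharP.cast_eq_zero _ 2
  rw [Int.cast_eq_of_emod_eq (p := 2) hb] at h h'
  rw [laMacchia_eval] at h
  rw [laMacchia_derivative_eval] at h'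
  push_cast at h h' h2
  refine one_ne_zero (α := k) ?_
  linear_combination -h + (-x - 1) * h' - (-4 * x ^ 7 - 20 * x ^ 4 + 4 * x ^ 3 + 6 * x ^ 2 -
    3 * x + 1) * h2

theorem laMacchia_separable_three [CharP k 3] (hb : b % 3 = 1)
    (h : (laMacchia (b : k)).eval x = 0) : (derivative (laMacchia (b : k))).eval x ≠ 0 := by
  intro h'
  have h3 : ((3 : ℕ) : k) = 0 := CharP.cast_eq_zero _ 3
  rw [Int.cast_eq_of_emod_eq (p := 3) hb] at h h'
  rw [laMacchia_eval] at h
  rw [laMacchia_derivative_eval] at h'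
  push_cast at h h' h3
  refine one_ne_zero (α := k) ?_
  linear_combination (x ^ 5 + x ^ 4 + x ^ 3 - x ^ 2 - x) * h +
    (-x ^ 6 + x ^ 4 + x ^ 3 - x ^ 2 + x + 1) * h' - (-2 * x ^ 12 + 2 * x ^ 11 + x ^ 10 -
    7 * x ^ 9 + 6 * x ^ 8 + 13 * x ^ 7 - 5 * x ^ 6 - 14 * x ^ 5 + 23 * x ^ 4 - 5 * x ^ 3 -
    4 * x ^ 2 + 3 * x - 1) * h3

theorem laMacchia_separable_five [CharP k 5] (hb : b % 5 = 4)
    (h : (laMacchia (b : k)).eval x = 0) : (derivative (laMacchia (b : k))).eval x ≠ 0 := by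
  intro h'
  have h5 : ((5 : ℕ) : k) = 0 := CharP.cast_eq_zero _ 5
  rw [Int.cast_eq_of_emod_eq (p := 5) hb] at h h'
  rw [laMacchia_eval] at h
  rw [laMacchia_derivative_eval] at h'
  push_cast at h h' h5
  refine one_ne_zero (α := k) ?_
  linear_combination (2 * x ^ 5 + x ^ 3 - x ^ 2 + 1) * h + (-x ^ 6 + x ^ 3 - x ^ 2 - x) * h' -
    (-x ^ 12 + 8 * x ^ 11 - 22 * x ^ 10 + 14 * x ^ 8 + 40 * x ^ 7 - 43 * x ^ 6 - 64 * x ^ 5 +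
    84 * x ^ 4 - 28 * x ^ 3 - 16 * x ^ 2 - 13) * h5

theorem laMacchia_separable_seven [CharP k 7] (hb : b % 7 = 2)
    (h : (laMacchia (b : k)).eval x = 0) : (derivative (laMacchia (b : k))).eval x ≠ 0 := by
  intro h'
  have h7 : ((7 : ℕ) : k) = 0 := CharP.cast_eq_zero _ 7
  rw [Int.cast_eq_of_emod_eq (p := 7) hb] at h h'
  rw [laMacchia_eval] at h
  rw [laMacchia_derivative_eval] at h'
  push_cast at h h' h7
  refine one_ne_zero (α := k) ?_
  linear_combination (-2 * x ^ 4 - 3 * x ^ 3 + 2 * x ^ 2 - x) * h +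
    (-3 * x ^ 6 + x ^ 5 - 3 * x ^ 4 + 3 * x ^ 3 - x - 2) * h' - (-3 * x ^ 12 + 11 * x ^ 11 -
    25 * x ^ 10 + 2 * x ^ 9 - x ^ 8 - 24 * x ^ 7 + 63 * x ^ 6 - 69 * x ^ 5 + 18 * x ^ 4 -
    4 * x ^ 3 + 12 * x ^ 2 - 12 * x + 1) * h7

end Separability

/-! ### Primes dividing b: the roots and their complementary divisors of b -/

section Dual

variable {A B : Type*} [CommRing A] [CommRing B]

/-- The monic polynomial whose roots are the quotients of `b` by the roots of `laMacchia b`. -/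
noncomputable def laMacchiaDual (b : A) : A[X] :=
  X ^ 7 + C (3 - b) * X ^ 6 + C (-b ^ 2 - 4 * b) * X ^ 5 +
    C (b ^ 3 - b ^ 2 + 11 * b - 2) * X ^ 4 + C (3 * b ^ 3 - 12 * b ^ 2 + 2 * b) * X ^ 3 +
    C (-2 * b ^ 4 - 2 * b ^ 3 + 3 * b ^ 2) * X ^ 2 + C (3 * b ^ 4 - 2 * b ^ 3) * X - C (b ^ 4)

theorem laMacchiaDual_map (φ : A →+* B) (b : A) :
    (laMacchiaDual b).map φ = laMacchiaDual (φ b) := by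
  simp only [laMacchiaDual, Polynomial.map_sub, Polynomial.map_add, Polynomial.map_mul,
    Polynomial.map_pow, map_X, map_C, Polynomial.map_neg,
    Polynomial.map_ofNat, map_sub, map_add, map_mul, map_pow, map_neg, map_ofNat]

theorem laMacchiaDual_eval (b x : A) : (laMacchiaDual b).eval x =
    x ^ 7 + (3 - b) * x ^ 6 + (-b ^ 2 - 4 * b) * x ^ 5 +
    (b ^ 3 - b ^ 2 + 11 * b - 2) * x ^ 4 + (3 * b ^ 3 - 12 * b ^ 2 + 2 * b) * x ^ 3 +
    (-2 * b ^ 4 - 2 * b ^ 3 + 3 * b ^ 2) * x ^ 2 + (3 * b ^ 4 - 2 * b ^ 3) * x - b ^ 4 := by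
  simp [laMacchiaDual]

theorem laMacchiaDual_monic (b : A) : (laMacchiaDual b).Monic := by
  unfold laMacchiaDual
  monicity!

theorem laMacchiaDual_natDegree [Nontrivial A] (b : A) : (laMacchiaDual b).natDegree = 7 := by
  unfold laMacchiaDual
  compute_degree!

/-- The common factor of `laMacchia b` at `x` and `laMacchiaDual b` at `w` for `b = x * w`. -/
def laMacchiaCofactor (x w : A) : A :=
  x ^ 4 + (2 - 3 * (x * w)) * x ^ 3 + (2 * (x * w) ^ 2 + 2 * (x * w) - 3) * x ^ 2 +
    (-3 * (x * w) ^ 2 + 12 * (x * w) - 2) * x + (-(x * w) ^ 3 + (x * w) ^ 2 - 11 * (x * w) + 2) +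
    (x ^ 2 * w ^ 3 + 4 * x * w ^ 2) + (x * w ^ 3 - 3 * w ^ 2) - w ^ 3

theorem laMacchia_eval_mul (x w : A) :
    (laMacchia (x * w)).eval x = x ^ 3 * laMacchiaCofactor x w := by
  rw [laMacchia_eval, laMacchiaCofactor]; ring

theorem laMacchiaDual_eval_mul (x w : A) :
    (laMacchiaDual (x * w)).eval w = -w ^ 4 * laMacchiaCofactor x w := by
  rw [laMacchiaDual_eval, laMacchiaCofactor]; ring

/-- At b = 0 the septic is x³ times a quartic; a Bézout identity between the quartic and its
derivative has value 6. The dual septic is likewise w⁴ times a cubic. -/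
theorem laMacchia_zero_separable {k : Type*} [Field k] (h2 : (2 : k) ≠ 0) (h3 : (3 : k) ≠ 0)
    {x : k} (hx : x ≠ 0) (h : (laMacchia (0 : k)).eval x = 0) :
    (derivative (laMacchia (0 : k))).eval x ≠ 0 := by
  intro h'
  rw [laMacchia_eval] at h
  rw [laMacchia_derivative_eval] at h'
  have hg : x ^ 4 + 2 * x ^ 3 - 3 * x ^ 2 - 2 * x + 2 = 0 :=
    (mul_eq_zero.1 (by linear_combination h :
      x ^ 3 * (x ^ 4 + 2 * x ^ 3 - 3 * x ^ 2 - 2 * x + 2) = 0)).resolve_left (pow_ne_zero _ hx)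
  have hg' : 4 * x ^ 3 + 6 * x ^ 2 - 6 * x - 2 = 0 :=
    (mul_eq_zero.1 (by linear_combination h' - 3 * x ^ 2 * hg :
      x ^ 3 * (4 * x ^ 3 + 6 * x ^ 2 - 6 * x - 2) = 0)).resolve_left (pow_ne_zero _ hx)
  refine mul_ne_zero h2 h3 ?_
  linear_combination (-16 * x ^ 2 - 36 * x - 6) * hg + (4 * x ^ 3 + 11 * x ^ 2 - 3 * x - 9) * hg'

theorem laMacchiaDual_zero_separable {k : Type*} [Field k] (h2 : (2 : k) ≠ 0) (h3 : (3 : k) ≠ 0)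
    {x : k} (hx : x ≠ 0) (h : (laMacchiaDual (0 : k)).eval x = 0) :
    (derivative (laMacchiaDual (0 : k))).eval x ≠ 0 := by
  intro h'
  rw [laMacchiaDual_eval] at h
  simp [laMacchiaDual] at h'
  have hg : x ^ 3 + 3 * x ^ 2 - 2 = 0 :=
    (mul_eq_zero.1 (by linear_combination h :
      x ^ 4 * (x ^ 3 + 3 * x ^ 2 - 2) = 0)).resolve_left (pow_ne_zero _ hx)
  have hg' : 3 * x ^ 2 + 6 * x = 0 :=
    (mul_eq_zero.1 (by linear_combination h' - 4 * x ^ 3 * hg :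
      x ^ 4 * (3 * x ^ 2 + 6 * x) = 0)).resolve_left (pow_ne_zero _ hx)
  refine mul_ne_zero h2 h3 ?_
  linear_combination (-3 * x - 3) * hg + (x ^ 2 + 2 * x - 1) * hg'

end Dual

/-! ### Inertia groups -/

section Inertia

variable {K : Type*} [Field K] [NumberField K] {b : ℤ} {r : ZMod 7 → 𝓞 K}

theorem laMacchia_map_eval {A k : Type*} [CommRing A] [CommRing k] {r : ZMod 7 → A} (π : A →+* k)
    (h : laMacchia (b : A) = ∏ i, (X - C (r i))) (i : ZMod 7) :
    (laMacchia (b : k)).eval (π (r i)) = 0 := by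
  rw [laMacchia_map_prod π h, eval_prod]
  exact Finset.prod_eq_zero (Finset.mem_univ i) (by simp)

theorem laMacchia_exists_cofactor (hb : b ≠ 0) {x : 𝓞 K}
    (h : (laMacchia (b : 𝓞 K)).eval x = 0) :
    ∃ w : 𝓞 K, x * w = b ∧ laMacchiaCofactor x w = 0 := by
  have hbK : (b : K) ≠ 0 := Int.cast_ne_zero.2 hb
  have hxK : (laMacchia (b : K)).eval (x : K) = 0 := by
    have := congrArg (algebraMap (𝓞 K) K) h
    rw [laMacchia_eval] at this ⊢
    simpa only [map_add, map_sub, map_mul, map_pow, map_neg, map_ofNat, map_intCast,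
      map_zero] using this
  have hx0 : (x : K) ≠ 0 := by
    intro h0
    rw [h0, laMacchia_eval] at hxK
    exact pow_ne_zero 3 hbK (by linear_combination -hxK)
  obtain ⟨w, hw⟩ : ∃ w : K, (x : K) * w = b := ⟨b / x, mul_div_cancel₀ _ hx0⟩
  have hH : laMacchiaCofactor (x : K) w = 0 := by
    rw [← hw, laMacchia_eval_mul] at hxK
    exact (mul_eq_zero.1 hxK).resolve_left (pow_ne_zero _ hx0)
  have hint : IsIntegral ℤ w := ⟨laMacchiaDual b, laMacchiaDual_monic b, by
    rw [eval₂_eq_eval_map, laMacchiaDual_map, eq_intCast, ← hw, laMacchiaDual_eval_mul, hH,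
      mul_zero]⟩
  obtain ⟨w, rfl⟩ : ∃ y : 𝓞 K, (y : K) = w := ⟨⟨w, hint⟩, rfl⟩
  refine ⟨w, NumberField.RingOfIntegers.ext ?_, NumberField.RingOfIntegers.ext ?_⟩
  · push_cast
    exact hw
  · rw [laMacchiaCofactor] at hH ⊢
    push_cast
    exact hH

variable {Φ : (K ≃ₐ[ℚ] K) →* Perm (ZMod 7)} {k : Type*} [Field k] {π : 𝓞 K →+* k} {σ : K ≃ₐ[ℚ] K}

/-- If inertia moved the index, two distinct roots would have the same reduction, giving a double
root there. -/
theorem laMacchia_fixed_of_separable (hprod : laMacchia (b : 𝓞 K) = ∏ i, (X - C (r i)))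
    (hΦ : ∀ σ i, r (Φ σ i) = σ • r i) (hσ : ∀ x, π (σ • x) = π x) (i : ZMod 7)
    (hsep : (derivative (laMacchia (b : k))).eval (π (r i)) ≠ 0) : Φ σ i = i := by
  by_contra hne
  rw [laMacchia_map_prod π hprod] at hsep
  exact hsep (Polynomial.eval_derivative_prod_X_sub_C_eq_zero (ρ := fun i => π (r i))
    (Ne.symm hne) (by simp only [hΦ, hσ]))

/-- A root with nonzero reduction is simple modulo p. Otherwise its quotient w = b/r has nonzero
reduction and is a simple root of the dual septic, so inertia fixes w and hence r. -/
theorem laMacchia_fixed_of_cast_eq_zero (hb : b ≠ 0) (hr : Function.Injective r)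
    (hprod : laMacchia (b : 𝓞 K) = ∏ i, (X - C (r i)))
    (hΦ : ∀ σ i, r (Φ σ i) = σ • r i) (hσ : ∀ x, π (σ • x) = π x) (hbk : (b : k) = 0)
    (h2 : (2 : k) ≠ 0) (h3 : (3 : k) ≠ 0) (i : ZMod 7) : Φ σ i = i := by
  have heval := laMacchia_map_eval π hprod i
  by_cases hx : π (r i) = 0
  swap
  · refine laMacchia_fixed_of_separable hprod hΦ hσ i ?_
    rw [hbk] at heval ⊢
    exact laMacchia_zero_separable h2 h3 hx heval
  have hbO : (b : 𝓞 K) ≠ 0 := Int.cast_ne_zero.2 hb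
  choose w hw hH using fun i => laMacchia_exists_cofactor hb
    (laMacchia_map_eval (RingHom.id (𝓞 K)) hprod i)
  simp only [RingHom.id_apply] at hw hH
  have hr0 : ∀ i, r i ≠ 0 := fun i h0 => hbO (by rw [← hw i, h0, zero_mul])
  have hwinj : Function.Injective w := by
    intro i j hij
    have hw0 : w i ≠ 0 := fun h0 => hbO (by rw [← hw i, h0, mul_zero])
    exact hr (mul_right_cancel₀ hw0 ((hw i).trans (by rw [hij, hw j])))
  have hdual : laMacchiaDual (b : 𝓞 K) = ∏ i, (X - C (w i)) :=
    (laMacchiaDual_monic _).eq_prod_X_sub_C_of_injective hwinj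
      (fun i => by rw [← hw i, laMacchiaDual_eval_mul, hH, mul_zero])
      (by rw [laMacchiaDual_natDegree, ZMod.card])
  have hwσ : w (Φ σ i) = σ • w i := by
    refine mul_left_cancel₀ (hr0 (Φ σ i)) ?_
    rw [hw, hΦ, ← smul_mul', hw]
    exact (map_intCast (MulSemiringAction.toRingHom (K ≃ₐ[ℚ] K) (𝓞 K) σ) b).symm
  have hdual' : laMacchiaDual (0 : k) = ∏ i, (X - C (π (w i))) := by
    have := congrArg (Polynomial.map π) hdual
    rw [laMacchiaDual_map, Polynomial.map_prod, map_intCast, hbk] at this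
    simpa using this
  -- The root and its quotient cannot both reduce to 0: the cofactor vanishes at them but has
  -- constant term 2.
  by_cases hw0 : π (w i) = 0
  · exfalso
    have := congrArg π (hH i)
    simp only [laMacchiaCofactor, map_add, map_sub, map_mul, map_neg, map_pow, map_ofNat, hx, hw0,
      map_zero] at this
    exact h2 (by linear_combination this)
  · by_contra hne
    refine laMacchiaDual_zero_separable h2 h3 hw0 ?_ ?_
    · rw [hdual', eval_prod]
      exact Finset.prod_eq_zero (Finset.mem_univ i) (by simp)
    · rw [hdual']
      exact Polynomial.eval_derivative_prod_X_sub_C_eq_zero (ρ := fun i => π (w i))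
        (Ne.symm hne) (by simp only [hwσ, hσ])

theorem NumberField.exists_prime_mem {P : Ideal (𝓞 K)} (hP : P.IsMaximal) :
    ∃ p : ℕ, p.Prime ∧ (p : 𝓞 K) ∈ P := by
  have := Ideal.finiteQuotientOfFreeOfNeBot P (Ideal.IsMaximal.ne_bot_of_isIntegral_int P)
  let := Ideal.Quotient.field P
  obtain ⟨p, hp⟩ := CharP.exists (𝓞 K ⧸ P)
  refine ⟨p, (CharP.char_is_prime_or_zero (𝓞 K ⧸ P) p).resolve_right
    (CharP.char_ne_zero_of_finite (𝓞 K ⧸ P) p), Ideal.Quotient.eq_zero_iff_mem.1 ?_⟩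
  simp

theorem CharP.natCast_ne_zero_of_prime_ne {k : Type*} [Field k] {p q : ℕ} [CharP k p]
    (hp : p.Prime) (hq : q.Prime) (h : p ≠ q) : (q : k) ≠ 0 := fun h0 =>
  h ((Nat.prime_dvd_prime_iff_eq hp hq).1 ((CharP.cast_eq_zero_iff k p q).1 h0))

/-- Inertia is trivial over the divisors of `210 * b` and has order at most two elsewhere. -/
theorem laMacchia_inertia [IsGalois ℚ K] [IsSplittingField ℚ K (laMacchia (b : ℚ))]
    (hb : b % 210 = 79) (P : Ideal (𝓞 K)) (hP : P.IsMaximal) :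
    (∀ p : ℕ, p.Prime → (p : 𝓞 K) ∈ P → (p ∣ 210 ∨ (p : ℤ) ∣ b) →
      P.inertia (K ≃ₐ[ℚ] K) = ⊥) ∧
    (P.inertia (K ≃ₐ[ℚ] K) ≠ ⊥ → Nat.card (P.inertia (K ≃ₐ[ℚ] K)) = 2) := by
  obtain ⟨r, hr, hprod, Φ, hΦinj, hΦrange, hΦ⟩ := laMacchia_exists_permHom (K := K) (b := b)
    (by rw [Int.odd_iff]; omega) (by omega)
  have hb0 : b ≠ 0 := by omega
  have hfix : ∀ σ, (∀ i, Φ σ i = i) → σ = 1 := fun σ hσ =>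
    (injective_iff_map_eq_one Φ).1 hΦinj σ (Equiv.ext hσ)
  have hone : ∀ p : ℕ, p.Prime → (p : 𝓞 K) ∈ P → (p ∣ 210 ∨ (p : ℤ) ∣ b) →
      P.inertia (K ≃ₐ[ℚ] K) = ⊥ := by
    intro p hp hpP hdvd
    have := Fact.mk hp
    obtain ⟨k, _, _, π, hker⟩ := NumberField.exists_residueField K P hP p hpP
    rw [eq_bot_iff]
    intro σ hσ
    have hσ' : ∀ x, π (σ • x) = π x := fun x => by
      rw [← sub_eq_zero, ← map_sub, ← RingHom.mem_ker, hker]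
      exact hσ x
    refine hfix σ fun i => ?_
    have heval := laMacchia_map_eval π hprod i
    have hcases : p = 2 ∨ p = 3 ∨ p = 5 ∨ p = 7 ∨ (p : ℤ) ∣ b := by
      rcases hdvd with h | h
      · rw [show 210 = 2 * 3 * 5 * 7 by norm_num] at h
        have hd : ∀ q : ℕ, q.Prime → p ∣ q → p = q := fun q hq h =>
          (Nat.prime_dvd_prime_iff_eq hp hq).1 h
        rcases hp.dvd_mul.1 h with h | h
        · rcases hp.dvd_mul.1 h with h | h
          · rcases hp.dvd_mul.1 h with h | h
            · exact Or.inl (hd 2 (by norm_num) h)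
            · exact Or.inr (Or.inl (hd 3 (by norm_num) h))
          · exact Or.inr (Or.inr (Or.inl (hd 5 (by norm_num) h)))
        · exact Or.inr (Or.inr (Or.inr (Or.inl (hd 7 (by norm_num) h))))
      · exact Or.inr (Or.inr (Or.inr (Or.inr h)))
    by_cases h2 : p = 2
    · subst h2
      exact laMacchia_fixed_of_separable hprod hΦ hσ' i
        (laMacchia_separable_two (by omega) heval)
    by_cases h3 : p = 3
    · subst h3
      exact laMacchia_fixed_of_separable hprod hΦ hσ' i
        (laMacchia_separable_three (by omega) heval)
    rcases hcases with rfl | rfl | rfl | rfl | h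
    · exact absurd rfl h2
    · exact absurd rfl h3
    · exact laMacchia_fixed_of_separable hprod hΦ hσ' i
        (laMacchia_separable_five (by omega) heval)
    · exact laMacchia_fixed_of_separable hprod hΦ hσ' i
        (laMacchia_separable_seven (by omega) heval)
    · refine laMacchia_fixed_of_cast_eq_zero hb0 hr hprod hΦ hσ'
        ((CharP.intCast_eq_zero_iff k p b).2 h) ?_ ?_ i
      · exact_mod_cast CharP.natCast_ne_zero_of_prime_ne (k := k) hp Nat.prime_two h2
      · exact_mod_cast CharP.natCast_ne_zero_of_prime_ne (k := k) hp Nat.prime_three h3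
  refine ⟨hone, fun hne => ?_⟩
  obtain ⟨p, hp, hpP⟩ := NumberField.exists_prime_mem hP
  have := Fact.mk hp
  have hp' : ¬ (p ∣ 210 ∨ (p : ℤ) ∣ b) := fun h => hne (hone p hp hpP h)
  rw [not_or] at hp'
  obtain ⟨k, _, _, π, hker⟩ := NumberField.exists_residueField K P hP p hpP
  have hmem : ∀ σ ∈ P.inertia (K ≃ₐ[ℚ] K), ∀ i, π (r (Φ σ i)) = π (r i) := fun σ hσ i => by
    rw [hΦ, ← sub_eq_zero, ← map_sub, ← RingHom.mem_ker, hker]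
    exact hσ (r i)
  have hq : ∀ q : ℕ, q.Prime → q ∣ 210 → (q : k) ≠ 0 := fun q hq hd =>
    CharP.natCast_ne_zero_of_prime_ne hp hq fun h => hp'.1 (h ▸ hd)
  have h2 : (2 : k) ≠ 0 := by exact_mod_cast hq 2 (by norm_num) (by norm_num)
  have h3 : (3 : k) ≠ 0 := by exact_mod_cast hq 3 (by norm_num) (by norm_num)
  have h7 : (7 : k) ≠ 0 := by exact_mod_cast hq 7 (by norm_num) (by norm_num)
  classical
  have h5 := laMacchia_five_le_card (fun h => hp'.2 ((CharP.intCast_eq_zero_iff k p b).1 h))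
    h2 h3 h7 (laMacchia_map_prod π hprod)
  have hmemΦ : ∀ σ, Φ σ ∈ fanoAut := fun σ => hΦrange ▸ ⟨σ, rfl⟩
  -- Any two nontrivial inertia elements preserve the fibres of reduction on the roots, which take
  -- at least five values, so they coincide.
  rw [Nat.card_eq_two_iff' (1 : P.inertia (K ≃ₐ[ℚ] K))]
  obtain ⟨τ, hτ⟩ := (Subgroup.ne_bot_iff_exists_ne_one).1 hne
  have hΦ1 : ∀ σ : P.inertia (K ≃ₐ[ℚ] K), σ ≠ 1 → Φ σ ≠ 1 := fun σ hσ h =>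
    hσ (Subtype.ext ((injective_iff_map_eq_one Φ).1 hΦinj _ h))
  exact ⟨τ, hτ, fun σ hσ => Subtype.ext <| hΦinj <|
    fanoAut_eq_of_fiber h5 (hmemΦ σ) (hΦ1 σ hσ) (hmem σ σ.2) (hmemΦ τ) (hΦ1 τ hτ) (hmem τ τ.2)⟩

end Inertia

/-! ### Real roots and total reality -/

section Real

/-- A real function with alternating signs at eight points has seven zeros. -/
theorem Continuous.exists_injective_zero {n : ℕ} {f : ℝ → ℝ} (hf : Continuous f)
    {a : Fin (n + 1) → ℝ} (ha : StrictMono a)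
    (hs : ∀ i : Fin n, f (a i.castSucc) * f (a i.succ) < 0) :
    ∃ t : Fin n → ℝ, Function.Injective t ∧ ∀ i, f (t i) = 0 := by
  have h : ∀ i : Fin n, ∃ t ∈ Set.Ioo (a i.castSucc) (a i.succ), f t = 0 := by
    intro i
    have hlt := ha i.castSucc_lt_succ
    rcases mul_neg_iff.1 (hs i) with ⟨h1, h2⟩ | ⟨h1, h2⟩
    · exact intermediate_value_Ioo' hlt.le hf.continuousOn ⟨h2, h1⟩
    · exact intermediate_value_Ioo hlt.le hf.continuousOn ⟨h1, h2⟩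
  choose t ht h0 using h
  refine ⟨t, StrictMono.injective fun i j hij => ?_, h0⟩
  exact (ht i).2.trans_le ((ha.monotone (Fin.succ_le_castSucc_iff.2 hij)).trans (ht j).1.le)

theorem laMacchia_exists_real_roots {b : ℤ} (hb : 20 ≤ b) :
    ∃ t : Fin 7 → ℝ, Function.Injective t ∧ ∀ i, (laMacchia (b : ℝ)).eval (t i) = 0 := by
  -- After the shift b = c + 20, each test value is, up to sign, a polynomial in c with nonnegative
  -- coefficients and positive constant term.
  obtain ⟨c, hc⟩ : ∃ c : ℝ, (b : ℝ) = c + 20 := ⟨b - 20, by ring⟩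
  have hc0 : 0 ≤ c := by
    have : (20 : ℝ) ≤ b := by exact_mod_cast hb
    linarith
  rw [hc]
  have e0 : (laMacchia (c + 20)).eval (-(c + 20)) < 0 := by
    have : (laMacchia (c + 20)).eval (-(c + 20)) = -(6 * c ^ 7 + 842 * c ^ 6 + 50625 * c ^ 5 +
        1690488 * c ^ 4 + 33859040 * c ^ 3 + 406771200 * c ^ 2 + 2714016000 * c +
        7758080000) := by
      rw [laMacchia_eval]; ring
    rw [this, neg_lt_zero]; positivity
  have e1 : 0 < (laMacchia (c + 20)).eval (-2) := by
    have : (laMacchia (c + 20)).eval (-2) = 9 * c ^ 3 + 442 * c ^ 2 + 6904 * c + 33328 := by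
      rw [laMacchia_eval]; ring
    rw [this]; positivity
  have e2 : (laMacchia (c + 20)).eval 0 < 0 := by
    have : (laMacchia (c + 20)).eval 0 = -(c + 20) ^ 3 := by
      rw [laMacchia_eval]; ring
    rw [this, neg_lt_zero]; positivity
  have e3 : 0 < (laMacchia (c + 20)).eval 1 := by
    have : (laMacchia (c + 20)).eval 1 = (c + 20) ^ 2 := by
      rw [laMacchia_eval]; ring
    rw [this]; positivity
  have e4 : (laMacchia (c + 20)).eval 2 < 0 := by
    have : (laMacchia (c + 20)).eval 2 = -(3 * c ^ 3 + 146 * c ^ 2 + 2264 * c + 10736) := by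
      rw [laMacchia_eval]; ring
    rw [this, neg_lt_zero]; positivity
  have e5 : 0 < (laMacchia (c + 20)).eval ((c + 20) / 2) := by
    have : (laMacchia (c + 20)).eval ((c + 20) / 2) = 3 / 128 * c ^ 7 + 49 / 16 * c ^ 6 +
        5493 / 32 * c ^ 5 + 42825 / 8 * c ^ 4 + 401491 / 4 * c ^ 3 + 1132365 * c ^ 2 +
        7122300 * c + 19282000 := by
      rw [laMacchia_eval]; ring
    rw [this]; positivity
  have e6 : (laMacchia (c + 20)).eval (c + 21) < 0 := by
    have : (laMacchia (c + 20)).eval (c + 21) = -(c ^ 6 + 106 * c ^ 5 + 4546 * c ^ 4 +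
        99621 * c ^ 3 + 1146837 * c ^ 2 + 6200278 * c + 10078760) := by
      rw [laMacchia_eval]; ring
    rw [this, neg_lt_zero]; positivity
  have e7 : 0 < (laMacchia (c + 20)).eval (2 * (c + 20)) := by
    have : (laMacchia (c + 20)).eval (2 * (c + 20)) = 136 * c ^ 6 + 16428 * c ^ 5 +
        826698 * c ^ 4 + 22183849 * c ^ 3 + 334795740 * c ^ 2 + 2694346800 * c +
        9033352000 := by
      rw [laMacchia_eval]; ring
    rw [this]; positivity
  refine (laMacchia (c + 20)).continuous.exists_injective_zero
    (a := ![-(c + 20), -2, 0, 1, 2, (c + 20) / 2, c + 21, 2 * (c + 20)]) ?_ ?_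
  · rw [Fin.strictMono_iff_lt_succ]
    intro i
    fin_cases i <;> simp <;> linarith
  · intro i
    fin_cases i
    exacts [mul_neg_of_neg_of_pos e0 e1, mul_neg_of_pos_of_neg e1 e2, mul_neg_of_neg_of_pos e2 e3,
      mul_neg_of_pos_of_neg e3 e4, mul_neg_of_neg_of_pos e4 e5, mul_neg_of_pos_of_neg e5 e6,
      mul_neg_of_neg_of_pos e6 e7]

theorem laMacchia_rootSet_subset_real {b : ℤ} (hb : 20 ≤ b) :
    (laMacchia (b : ℚ)).rootSet ℂ ⊆ Set.range Complex.ofReal := by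
  obtain ⟨t, ht, h0⟩ := laMacchia_exists_real_roots hb
  have hprod : laMacchia (b : ℂ) = ∏ i, (X - C (t i : ℂ)) := by
    refine (laMacchia_monic _).eq_prod_X_sub_C_of_injective (Complex.ofReal_injective.comp ht)
      (fun i => ?_) (by rw [laMacchia_natDegree, Fintype.card_fin])
    have := congrArg Complex.ofRealHom (h0 i)
    rw [laMacchia_eval] at this ⊢
    simpa using this
  intro y hy
  have hy0 : (laMacchia (b : ℂ)).eval y = 0 := by
    have := (mem_rootSet.1 hy).2
    rw [aeval_def, eval₂_eq_eval_map, laMacchia_map] at this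
    simpa using this
  rw [hprod] at hy0
  obtain ⟨i, hi⟩ := Polynomial.exists_eq_of_eval_prod_X_sub_C_eq_zero hy0
  exact ⟨t i, hi⟩

/-- By normality every complex embedding of K has image K itself, so all embeddings are real as soon
as one is. -/
theorem IntermediateField.isTotallyReal_of_subset_real {K : IntermediateField ℚ ℂ} [Normal ℚ K]
    (h : ∀ x ∈ K, x ∈ Set.range Complex.ofReal) : NumberField.IsTotallyReal K := by
  refine ⟨fun v => NumberField.InfinitePlace.isReal_iff.2 ?_⟩
  rw [NumberField.ComplexEmbedding.isReal_iff]
  ext x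
  have hx : v.embedding x ∈ K := by
    let φ : K →ₐ[ℚ] ℂ := { v.embedding with commutes' q := by simp }
    have hn : @Normal ℚ K _ _ K.algebra' := by
      convert ‹Normal ℚ K›
      exact Subsingleton.elim _ _
    exact (AlgHom.fieldRange_of_normal φ).le ⟨x, rfl⟩
  obtain ⟨y, hy⟩ := h _ hx
  rw [NumberField.ComplexEmbedding.conjugate_coe_eq, ← hy, Complex.conj_ofReal]

end Real

/-! ### Choice of parameters and infinitude -/

theorem fanoAut_nontrivial : Nontrivial fanoAut :=
  ⟨⟨fanoRot, fanoRot_mem⟩, 1, fun h => by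
    have := DFunLike.congr_fun (congrArg Subtype.val h) 0
    exact absurd this (by decide)⟩

theorem exists_modEq_of_forall_prime_dvd (N : ℕ) (hN : N ≠ 0) :
    ∃ b : ℤ, 20 ≤ b ∧ b % 210 = 79 ∧ ∀ p : ℕ, p.Prime → p ∣ N → p ∣ 210 ∨ (p : ℤ) ∣ b := by
  set M := ∏ p ∈ N.primeFactors with ¬ p ∣ 210, p with hM
  have hcop : M.Coprime 210 := Nat.Coprime.prod_left fun p hp => by
    rw [Finset.mem_filter] at hp
    exact ((Nat.prime_of_mem_primeFactors hp.1).coprime_iff_not_dvd).2 hp.2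
  have hM0 : 0 < M := Finset.prod_pos fun p hp =>
    (Nat.prime_of_mem_primeFactors (Finset.mem_filter.1 hp).1).pos
  -- Euler's theorem gives `M ^ φ(210) ≡ 1 mod 210`, so the factor 79 fixes the residue class while
  -- divisibility by M is kept.
  refine ⟨(79 * M ^ Nat.totient 210 : ℕ), ?_, ?_, fun p hp hpN => ?_⟩
  · have : 0 < M ^ Nat.totient 210 := pow_pos hM0 _
    omega
  · have h := (Nat.ModEq.pow_totient hcop).mul_left 79
    have h' : 79 * M ^ Nat.totient 210 % 210 = 79 := h
    omega
  · by_cases h : p ∣ 210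
    · exact Or.inl h
    · right
      have h1 : p ∣ M := Finset.dvd_prod_of_mem (fun p => p)
        (Finset.mem_filter.2 ⟨Nat.mem_primeFactors.2 ⟨hp, hpN, hN⟩, h⟩)
      exact Int.natCast_dvd_natCast.2 ((h1.trans (dvd_pow_self M (by decide))).mul_left 79)

/-- The last clause, unramifiedness at all divisors of 210 b, is what separates the new field from a
given finite list. -/
theorem laMacchia_exists_intermediateField {b : ℤ} (hb : b % 210 = 79) (hb20 : 20 ≤ b) :
    ∃ K : IntermediateField ℚ ℂ, (FiniteDimensional ℚ K ∧ IsGalois ℚ K ∧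
      Nonempty ((K ≃ₐ[ℚ] K) ≃* PSL(2, ZMod 7)) ∧
      (∀ P : Ideal (𝓞 K), P.IsMaximal → P.inertia (K ≃ₐ[ℚ] K) ≠ ⊥ →
        Nat.card (P.inertia (K ≃ₐ[ℚ] K)) = 2) ∧
      Algebra.IsUnramifiedIn (𝓞 K) (Ideal.span {(2 : ℤ)}) ∧
      (∀ x ∈ K, x ∈ Set.range Complex.ofReal) ∧
      NumberField.IsTotallyReal K) ∧
      ∀ p : ℕ, p.Prime → (p ∣ 210 ∨ (p : ℤ) ∣ b) →
        Algebra.IsUnramifiedIn (𝓞 K) (Ideal.span {(p : ℤ)}) := by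
  set K : IntermediateField ℚ ℂ := IntermediateField.adjoin ℚ ((laMacchia (b : ℚ)).rootSet ℂ)
  have hsplit : IsSplittingField ℚ K (laMacchia (b : ℚ)) :=
    IntermediateField.adjoin_rootSet_isSplittingField (IsAlgClosed.splits _)
  have hfin : FiniteDimensional ℚ K := IsSplittingField.finiteDimensional K (laMacchia (b : ℚ))
  have hnormal : Normal ℚ K := Normal.of_isSplittingField (laMacchia (b : ℚ))
  have hgal : IsGalois ℚ K := ⟨⟩
  have hnf : NumberField K := ⟨⟩
  have hreal : ∀ x ∈ K, x ∈ Set.range Complex.ofReal := by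
    have : K ≤ (Complex.ofRealAm.restrictScalars ℚ).fieldRange := by
      refine IntermediateField.adjoin_le_iff.2 ?_
      exact laMacchia_rootSet_subset_real hb20
    exact fun x hx => this hx
  have hunr : ∀ p : ℕ, p.Prime → (p ∣ 210 ∨ (p : ℤ) ∣ b) →
      Algebra.IsUnramifiedIn (𝓞 K) (Ideal.span {(p : ℤ)}) := by
    intro p hp hd
    have := Fact.mk hp
    exact NumberField.isUnramifiedIn_of_inertia_eq_bot p fun P hP hpP =>
      (laMacchia_inertia hb P hP).1 p hp hpP hd
  obtain ⟨r, -, -, Φ, hinj, hrange, -⟩ := laMacchia_exists_permHom (K := K) (b := b)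
    (by rw [Int.odd_iff]; omega) (by omega)
  exact ⟨K, ⟨hfin, hgal, ⟨(MonoidHom.ofInjective hinj).trans
      ((MulEquiv.subgroupCongr hrange).trans pslEquivFanoAut.symm)⟩,
    fun P hP => (laMacchia_inertia hb P hP).2, hunr 2 Nat.prime_two (Or.inl (by norm_num)), hreal,
    IntermediateField.isTotallyReal_of_subset_real hreal⟩, hunr⟩

theorem theorem3p2 :
    {K : IntermediateField ℚ ℂ |
      FiniteDimensional ℚ K ∧ IsGalois ℚ K ∧
      Nonempty ((K ≃ₐ[ℚ] K) ≃* PSL(2, ZMod 7)) ∧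
      (∀ P : Ideal (𝓞 K), P.IsMaximal → P.inertia (K ≃ₐ[ℚ] K) ≠ ⊥ →
        Nat.card (P.inertia (K ≃ₐ[ℚ] K)) = 2) ∧
      Algebra.IsUnramifiedIn (𝓞 K) (Ideal.span {(2 : ℤ)}) ∧
      (∀ x ∈ K, x ∈ Set.range Complex.ofReal) ∧
      NumberField.IsTotallyReal K}.Infinite := by
  intro hfin
  have hram : ∀ K : IntermediateField ℚ ℂ, FiniteDimensional ℚ K → IsGalois ℚ K →
      Nonempty ((K ≃ₐ[ℚ] K) ≃* PSL(2, ZMod 7)) →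
      ∃ p : ℕ, p.Prime ∧ ¬ Algebra.IsUnramifiedIn (𝓞 K) (Ideal.span {(p : ℤ)}) := by
    rintro K hK hG ⟨e⟩
    have hnf : NumberField K := ⟨⟩
    -- Minkowski: a number field of degree greater than 1 has a ramified prime.
    refine NumberField.exists_not_isUnramifiedIn (K := K) (𝒪 := 𝓞 K) fun h => ?_
    have := fanoAut_nontrivial
    have hnt : Nontrivial (K ≃ₐ[ℚ] K) := (e.trans pslEquivFanoAut).toEquiv.nontrivial
    rw [← IsGalois.card_aut_eq_finrank] at h
    exact Finite.one_lt_card.ne' h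
  choose! p hp hpram using hram
  obtain ⟨b, hb20, hb, hdvd⟩ := exists_modEq_of_forall_prime_dvd (∏ K ∈ hfin.toFinset, p K) <| by
    rw [Finset.prod_ne_zero_iff]
    intro K hK
    obtain ⟨h1, h2, h3, -⟩ := hfin.mem_toFinset.1 hK
    exact (hp K h1 h2 h3).ne_zero
  obtain ⟨K, hK, hunr⟩ := laMacchia_exists_intermediateField hb hb20
  have hpK := hp K hK.1 hK.2.1 hK.2.2.1
  exact hpram K hK.1 hK.2.1 hK.2.2.1 (hunr _ hpK
    (hdvd _ hpK (Finset.dvd_prod_of_mem p (hfin.mem_toFinset.2 hK))))
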